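/- Let $\mathcal X$ be a finite alphabet with at least two symbols. Programs $p$ are binary strings, $\ell(\cdot)$ is the length of a string, $\epsilon$ the empty string, $y_{1:l}$ the prefix of $y$ of length $l$. *Prefix complexity.* A prefix machine is a partial computable function $V(p,y)\in\mathcal X^*$ ($p\in\{0,1\}^*$, $y\in\mathcal X^*$) such that for every $y$ the set of $p$ for which $V(p,y)$ is defined is prefix free. Fix an additively optimal prefix machine $U$ and put $K(x|y)=\min\{\ell(p): U(p,y)=x\}$, $K(x)=K(x|\epsilon)$; for $l\in\mathbb N$ put $K(l)=K(\langle l\rangle)$, where $\langle\cdot\rangle:\mathbb N\to\mathcal X^*$ is a fixed computable injective coding. *Complexity monotone in conditions.* A twice prefix machine $T$ has two one-way input tapes without delimiters, a binary program tape and a condition tape over $\mathcal X$; $T(p,x)=y$ means that, given a sequence beginning with $p$ on the first tape and a sequence beginning with $x$ on the second, $T$ halts after reading exactly $p$ and $x$ and prints $y$. Put $C_T(y|x)=\min\{\ell(p):\exists k\le \ell(x)\; T(p,x_{1:k})=y\}$. An enumerable set $E$ of triples $(p,x,y)\in\{0,1\}^*\times\mathcal X^*\times\mathcal X^*$ is called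 $K_*$-correct if (1) $(p,x,y_1),(p,x,y_2)\in E$ implies $y_1=y_2$; (2) $(p,x,y)\in E$ implies $(p',x',y)\in E$ whenever $p$ is a prefix of $p'$ and $x$ is a prefix of $x'$; (3) if $(p,x',y),(p',x,y)\in E$, $p$ is a prefix of $p'$ and $x$ is a prefix of $x'$, then $(p,x,y)\in E$. Put $C_E(y|x)=\min\{\ell(p):(p,x,y)\in E\}$. A twice prefix machine (or a set) is optimal in its class if its complexity is, up to an additive constant, at most that of every member of the class. Let $K_*(y|x*)$ be any one of: $C_U$ for an optimal twice prefix machine $U$; $C_E$ for an optimal $K_*$-correct set $E$; $C_E$ for a set $E$ that is optimal among the enumerable sets satisfying (1) and (2). Write $f\stackrel{+}{\le}g$ for $f\le g+O(1)$ and $f\stackrel{+}{=}g$ if both $f\stackrel{+}{\le}g$ and $g\stackrel{+}{\le}f$; the constants do not depend on $x,y$. **Lemma.** For all $x,y\in\mathcal X^*$, $$K(x|y)\;\stackrel{+}{\le}\;K_*(x|y*)\;\stackrel{+}{\le}\;\min_{l\le\ell(y)}\{K(x|y_{1:l})+K(l)\}\;\stackrel{+}{\le}\;K(x).$$ None of the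 three bounds $K(x|y)$, $\min_{l\le\ell(y)}\{K(x|y_{1:l})+K(l)\}$, $K(x)$ is equal to $K_*(x|y*)$ for all $x,y$ within an error term $o(K(x))$. The bounds are attained for certain $y$: for every $x$ there is a $y$ such that $$K(x|y)\stackrel{+}{=}0\quad\text{and}\quad K_*(x|y*)\stackrel{+}{=}\min_{l\le\ell(y)}\{K(x|y_{1:l})+K(l)\}\stackrel{+}{=}K(x),$$ and for every $x$ there is a $y$ such that $$K(x|y)\stackrel{+}{=}K_*(x|y*)\stackrel{+}{=}0\quad\text{and}\quad \min_{l\le\ell(y)}\{K(x|y_{1:l})+K(l)\}\stackrel{+}{=}K(x).$$ -/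

import Mathlib

open Filter Asymptotics

/-! Programs are binary strings (`List Bool`); conditions and outputs are strings over an
alphabet `X` (`List X`). All complexities take values in `ℕ∞`, the minimum of the empty set
being `⊤`. -/

/-! ### Prefix complexity -/

/-- A (conditional) prefix machine: a partial computable function of a program `p` and a
condition `y` (given in full) such that, for each condition, the set of halting programs is
prefix free. -/
def IsPrefixMachine {X : Type*} [Primcodable X]
    (V : List Bool × List X →. List X) : Prop :=
  Partrec V ∧
    ∀ (y : List X) (p q : List Bool), (V (p, y)).Dom → (V (q, y)).Dom → p <+: q → p = q

/-- The length of a shortest program `p` with `V (p, y) = x`. -/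
noncomputable def prefixComplexity {X : Type*} (V : List Bool × List X →. List X)
    (x y : List X) : ℕ∞ :=
  ⨅ (p : List Bool) (_ : x ∈ V (p, y)), (p.length : ℕ∞)

/-- An additively optimal prefix machine. -/
def IsOptimalPrefixMachine {X : Type*} [Primcodable X]
    (U : List Bool × List X →. List X) : Prop :=
  IsPrefixMachine U ∧
    ∀ V : List Bool × List X →. List X, IsPrefixMachine V →
      ∃ c : ℕ, ∀ x y : List X, prefixComplexity U x y ≤ prefixComplexity V x y + c

/-! ### Twice prefix machines -/

/-- What a machine with two input tapes does next: it requests the next symbol of the program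
tape, requests the next symbol of the condition tape, or halts with an output. -/
abbrev TapeAction (X : Type*) := Bool ⊕ List X

/-- Request the next symbol of the first (program) tape. -/
abbrev TapeAction.readProgram {X : Type*} : TapeAction X := Sum.inl false

/-- Request the next symbol of the second (condition) tape. -/
abbrev TapeAction.readCondition {X : Type*} : TapeAction X := Sum.inl true

/-- Halt and print `z`. -/
abbrev TapeAction.halt {X : Type*} (z : List X) : TapeAction X := Sum.inr z

/-- A machine with two one-way input tapes without delimiters. As the machine is deterministic,
its next action is determined by the portions `p` and `x` of the two tapes that it has read so
far, and it is a partial computable function of them (undefined if the machine computes forever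
without reading any further). -/
structure TwicePrefixMachine (X : Type*) [Primcodable X] where
  next : List Bool × List X →. TapeAction X
  partrec : Partrec next

/-- `T.Reads p x`: on tapes that begin with `p` and with `x`, at some moment of its run the
machine has read exactly `p` and `x`. -/
inductive TwicePrefixMachine.Reads {X : Type*} [Primcodable X] (T : TwicePrefixMachine X) :
    List Bool → List X → Prop
  | start : T.Reads [] []
  | readProgram (p : List Bool) (x : List X) (b : Bool) :
      T.Reads p x → TapeAction.readProgram ∈ T.next (p, x) → T.Reads (p ++ [b]) x
  | readCondition (p : List Bool) (x : List X) (a : X) :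
      T.Reads p x → TapeAction.readCondition ∈ T.next (p, x) → T.Reads p (x ++ [a])

/-- `T(p, x) = z`: the machine halts after reading exactly `p` and `x`, and prints `z`. -/
def TwicePrefixMachine.Outputs {X : Type*} [Primcodable X] (T : TwicePrefixMachine X)
    (p : List Bool) (x z : List X) : Prop :=
  T.Reads p x ∧ TapeAction.halt z ∈ T.next (p, x)

/-- `C_T(y|x) = min {ℓ(p) | ∃ k ≤ ℓ(x), T(p, x_{1:k}) = y}`. -/
noncomputable def TwicePrefixMachine.complexity {X : Type*} [Primcodable X]
    (T : TwicePrefixMachine X) (y x : List X) : ℕ∞ :=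
  ⨅ (p : List Bool) (_ : ∃ k ≤ x.length, T.Outputs p (x.take k) y), (p.length : ℕ∞)

/-- An optimal twice prefix machine. -/
def TwicePrefixMachine.IsOptimal {X : Type*} [Primcodable X] (U : TwicePrefixMachine X) : Prop :=
  ∀ T : TwicePrefixMachine X,
    ∃ c : ℕ, ∀ y x : List X, U.complexity y x ≤ T.complexity y x + c

/-! ### Enumerable sets of triples `(p, x, y)` -/

/-- An enumerable set of triples that is single valued and closed under prolongation of the
program and of the condition. -/
structure IsWeaklyKStarCorrect {X : Type*} [Primcodable X]
    (E : Set (List Bool × List X × List X)) : Prop where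
  enumerable : REPred fun t : List Bool × List X × List X => t ∈ E
  singleValued : ∀ p x y₁ y₂, (p, x, y₁) ∈ E → (p, x, y₂) ∈ E → y₁ = y₂
  prolong : ∀ p p' x x' y, (p, x, y) ∈ E → p <+: p' → x <+: x' → (p', x', y) ∈ E

/-- A `K_*`-correct set: in addition, if `(p, x', y)` and `(p', x, y)` are in the set, `p` is a
prefix of `p'` and `x` is a prefix of `x'`, then `(p, x, y)` is in the set. -/
structure IsKStarCorrect {X : Type*} [Primcodable X]
    (E : Set (List Bool × List X × List X)) : Prop extends IsWeaklyKStarCorrect E where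
  meet : ∀ p p' x x' y, (p, x', y) ∈ E → (p', x, y) ∈ E → p <+: p' → x <+: x' → (p, x, y) ∈ E

/-- `C_E(y|x) = min {ℓ(p) | (p, x, y) ∈ E}`. -/
noncomputable def setComplexity {X : Type*} (E : Set (List Bool × List X × List X))
    (y x : List X) : ℕ∞ :=
  ⨅ (p : List Bool) (_ : (p, x, y) ∈ E), (p.length : ℕ∞)

/-- `E` is optimal in the class of sets `P`. -/
def IsOptimalSet {X : Type*} (P : Set (List Bool × List X × List X) → Prop)
    (E : Set (List Bool × List X × List X)) : Prop :=
  P E ∧ ∀ E' : Set (List Bool × List X × List X), P E' →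
    ∃ c : ℕ, ∀ y x : List X, setComplexity E y x ≤ setComplexity E' y x + c

/-! ### Complexity monotone in conditions -/

/-- `C` is (a version of) the complexity monotone in conditions, `C y x = K_*(y|x*)`, in one of
its three definitions: by an optimal twice prefix machine, by an optimal `K_*`-correct set, or by
an optimal set among those that need not satisfy the third requirement. -/
def IsKStar {X : Type*} [Primcodable X] (C : List X → List X → ℕ∞) : Prop :=
  (∃ U : TwicePrefixMachine X, U.IsOptimal ∧ C = U.complexity) ∨
  (∃ E : Set (List Bool × List X × List X), IsOptimalSet IsKStarCorrect E ∧
    C = setComplexity E) ∨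
  (∃ E : Set (List Bool × List X × List X), IsOptimalSet IsWeaklyKStarCorrect E ∧
    C = setComplexity E)

/-! ### Auxiliary notation -/

/-- `min_{l ≤ ℓ(y)} {K(x|y_{1:l}) + K(l)}` where `K(x|y) = prefixComplexity U x y`,
`K(x) = K(x|ε)` and `K(l) = K(code l)`. -/
noncomputable def minBound {X : Type*} (U : List Bool × List X →. List X) (code : ℕ → List X)
    (x y : List X) : ℕ∞ :=
  ⨅ (l : ℕ) (_ : l ≤ y.length),
    prefixComplexity U x (y.take l) + prefixComplexity U (code l) []

/-- `A(x,y)` and `B(x,y)` are equal within an error term `o(K(x))`. -/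
def EqWithinLittleO {X : Type*} (K : List X → ℕ∞) (A B : List X → List X → ℕ∞) : Prop :=
  ∃ f : ℕ → ℕ, (fun n => (f n : ℝ)) =o[atTop] (fun n => (n : ℝ)) ∧
    ∀ (x y : List X) (n : ℕ), K x = n → A x y ≤ B x y + f n ∧ B x y ≤ A x y + f n

/-! All three versions of `K_*` are handled through two facts. Each is the complexity of an
enumerable set satisfying (1) and (2), which gives lower bounds. Each is also, up to a constant, at
most the complexity of any twice prefix machine, because the outputs of such a machine form a
`K_*`-correct set; this gives upper bounds.

Lower bound by `K(x|y)`: for a fixed condition, comparable programs in such a set have the same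
output (prefix stability). The Kraft–Chaitin construction replaces a prefix stable relation by a
prefix free one at a cost of two bits (`exists_prefixFree_of_prefixStable`), and optimality of `U`
applies. Upper bound by the minimum (`IsKStar.le_minBound`): a machine reads a program for `l`, then
`l` symbols of the condition, then a program for `x` given these symbols. The choice `l = 0` gives
the bound by `K(x)`.

Let `n` be the number of `x`. For `y = aⁿ` the full condition determines `x`, but the conditions
`aⁿ` are pairwise comparable, so the union of their slices is still prefix stable and `K_*(x|y*)` is
as large as `K(x)`. For `y = aⁿb` a machine can read up to the mark `b` without any program, so
`K_*` is bounded. The minimum stays near `K(x)`: for `l ≤ n` the prefix `aˡ` carries no more than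
`l`, and `l = n + 1` itself determines `x`. As `K` is unbounded, these gaps exclude equality within
`o(K(x))`. -/

/-! ### Enumerable predicates and dovetailed search -/

section RecursivelyEnumerable

variable {α β σ : Type*} [Primcodable α] [Primcodable β] [Primcodable σ]

/-- Clocked evaluation `evaln` of a code for `f`. Stages that are total and primitive recursive
allow bounded searches and sums over stages later. -/
theorem Partrec.exists_primrec_stage {f : α →. σ} (hf : Partrec f) :
    ∃ g : α → ℕ → Option σ, Primrec₂ g ∧ ∀ a b, b ∈ f a ↔ ∃ n, g a n = some b := by
  obtain ⟨c, hc⟩ := Nat.Partrec.Code.exists_code.1 hf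
  refine ⟨fun a n => (Nat.Partrec.Code.evaln n c (Encodable.encode a)).bind Encodable.decode,
    ?_, fun a b => ?_⟩
  · exact Primrec.option_bind
      (Nat.Partrec.Code.primrec_evaln.comp
        ((Primrec.snd.pair (Primrec.const c)).pair (Primrec.encode.comp Primrec.fst)))
      (Primrec.decode.comp Primrec.snd)
  · have key : ∀ m, m ∈ Nat.Partrec.Code.eval c (Encodable.encode a) ↔
        ∃ b ∈ f a, Encodable.encode b = m := by
      intro m
      rw [hc]
      simp
    constructor
    · intro hb
      obtain ⟨n, hn⟩ := Nat.Partrec.Code.evaln_complete.1 ((key _).2 ⟨b, hb, rfl⟩)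
      exact ⟨n, by simp [Option.mem_def.1 hn]⟩
    · rintro ⟨n, hn⟩
      obtain ⟨m, hm, hb⟩ := Option.bind_eq_some_iff.1 hn
      obtain ⟨b', hb', rfl⟩ := (key _).1 (Nat.Partrec.Code.evaln_sound hm)
      rw [Encodable.encodek] at hb
      exact Option.some.inj hb ▸ hb'

theorem REPred.exists_primrec_stage {p : α → Prop} (hp : REPred p) :
    ∃ D : α → ℕ → Bool, Primrec₂ D ∧ ∀ a, p a ↔ ∃ n, D a n = true := by
  obtain ⟨g, hg, h⟩ := Partrec.exists_primrec_stage hp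
  refine ⟨fun a n => (g a n).isSome, Primrec.option_isSome.comp hg, fun a => ?_⟩
  have := h a ()
  simp only [Part.mem_assert_iff, Part.mem_some_iff, exists_prop, and_true] at this
  rw [this]
  refine exists_congr fun n => ?_
  rw [Option.isSome_iff_exists]
  exact ⟨fun h => ⟨_, h⟩, fun ⟨_, h⟩ => h⟩

theorem REPred.of_computable_search {f : α → ℕ → Option σ} (hf : Computable₂ f) :
    REPred fun a => ∃ n b, b ∈ f a n :=
  (Partrec.rfindOpt hf).dom_re.of_eq fun _ => Nat.rfindOpt_dom

theorem REPred.comp {p : β → Prop} (hp : REPred p) {f : α → β} (hf : Computable f) :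
    REPred fun a => p (f a) :=
  Partrec.comp hp hf

theorem REPred.and {p q : α → Prop} (hp : REPred p) (hq : REPred q) :
    REPred fun a => p a ∧ q a := by
  refine (Partrec.bind hp (hq.comp Computable.fst).to₂).dom_re.of_eq fun a => ?_
  simp [Part.assert, Part.bind_dom]

theorem REPred.or {p q : α → Prop} (hp : REPred p) (hq : REPred q) :
    REPred fun a => p a ∨ q a := by
  obtain ⟨k, hk, h⟩ := Partrec.merge' hp hq
  refine hk.dom_re.of_eq fun a => ?_
  rw [(h a).2]
  simp [Part.assert]

/-- Existential quantification preserves enumerability. -/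
theorem REPred.exists {p : α → β → Prop} (hp : REPred fun t : α × β => p t.1 t.2) :
    REPred fun a => ∃ b, p a b := by
  obtain ⟨D, hD, h⟩ := hp.exists_primrec_stage
  -- Dovetailing: `k` codes a stage together with a candidate witness.
  let f : α → ℕ → Option Unit := fun a k =>
    (Encodable.decode (α := β) k.unpair.2).bind fun b =>
      if D (a, b) k.unpair.1 = true then some () else none
  have hf : Primrec₂ f := by
    refine Primrec.option_bind (Primrec.decode.comp (Primrec.snd.comp
      (Primrec.unpair.comp Primrec.snd))) ?_
    refine Primrec.ite (Primrec.primrecPred ?_) (Primrec.const _) (Primrec.const _)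
    have : Primrec₂ fun (x : α × ℕ) (b : β) => D (x.1, b) x.2.unpair.1 :=
      hD.comp ((Primrec.fst.comp Primrec.fst).pair Primrec.snd)
        (Primrec.fst.comp (Primrec.unpair.comp (Primrec.snd.comp Primrec.fst)))
    exact Primrec.of_eq this fun _ => by simp
  refine (REPred.of_computable_search hf.to_comp).of_eq fun a => ?_
  simp only [f, Option.mem_def, Option.bind_eq_some_iff]
  constructor
  · rintro ⟨k, _, b, _, hb⟩
    split at hb
    · exact ⟨b, (h (a, b)).2 ⟨_, by assumption⟩⟩
    · cases hb
  · rintro ⟨b, hb⟩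
    obtain ⟨n, hn⟩ := (h (a, b)).1 hb
    exact ⟨Nat.pair n (Encodable.encode b), (), b, by simp, by simp [hn]⟩

theorem PrimrecPred.rePred {p : α → Prop} (hp : PrimrecPred p) : REPred p :=
  hp.computablePred.to_re

theorem Partrec.rePred_graph {f : α →. σ} (hf : Partrec f) :
    REPred fun t : α × σ => t.2 ∈ f t.1 := by
  obtain ⟨g, hg, h⟩ := hf.exists_primrec_stage
  refine (REPred.exists (p := fun (t : α × σ) (n : ℕ) => g t.1 n = some t.2)
    (PrimrecPred.rePred ?_)).of_eq fun t => (h _ _).symm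
  exact Primrec.eq.comp (hg.comp (Primrec.fst.comp Primrec.fst) Primrec.snd)
    (Primrec.option_some.comp (Primrec.snd.comp Primrec.fst))

theorem Partrec.rePred_mem {f : β →. σ} (hf : Partrec f) {u : α → β} {v : α → σ}
    (hu : Computable u) (hv : Computable v) : REPred fun a => v a ∈ f (u a) :=
  hf.rePred_graph.comp (hu.pair hv)

/-- A single valued enumerable relation is the graph of a partial computable function. -/
theorem REPred.exists_partrec {R : α → σ → Prop} (hR : REPred fun t : α × σ => R t.1 t.2)
    (huniq : ∀ a b b', R a b → R a b' → b = b') :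
    ∃ f : α →. σ, Partrec f ∧ ∀ a b, b ∈ f a ↔ R a b := by
  obtain ⟨D, hD, h⟩ := hR.exists_primrec_stage
  let g : α → ℕ → Option σ := fun a k =>
    (Encodable.decode (α := σ) k.unpair.2).bind fun b =>
      if D (a, b) k.unpair.1 = true then some b else none
  have hg : Primrec₂ g := by
    refine Primrec.option_bind (Primrec.decode.comp (Primrec.snd.comp
      (Primrec.unpair.comp Primrec.snd))) ?_
    refine Primrec.ite (Primrec.primrecPred ?_) (Primrec.option_some.comp Primrec.snd)
      (Primrec.const _)
    have : Primrec₂ fun (x : α × ℕ) (b : σ) => D (x.1, b) x.2.unpair.1 :=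
      hD.comp ((Primrec.fst.comp Primrec.fst).pair Primrec.snd)
        (Primrec.fst.comp (Primrec.unpair.comp (Primrec.snd.comp Primrec.fst)))
    exact Primrec.of_eq this fun _ => by simp
  have sound : ∀ a b k, b ∈ g a k → R a b := by
    intro a b k hb
    simp only [g, Option.mem_def, Option.bind_eq_some_iff] at hb
    obtain ⟨b', _, hb'⟩ := hb
    split at hb'
    · cases hb'
      exact (h (a, b)).2 ⟨_, by assumption⟩
    · cases hb'
  refine ⟨_, Partrec.rfindOpt hg.to_comp, fun a b => ⟨fun hb => ?_, fun hb => ?_⟩⟩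
  · obtain ⟨k, hk⟩ := Nat.rfindOpt_spec hb
    exact sound _ _ _ hk
  · obtain ⟨n, hn⟩ := (h (a, b)).1 hb
    have hdom : (Nat.rfindOpt (g a)).Dom :=
      Nat.rfindOpt_dom.2 ⟨Nat.pair n (Encodable.encode b), b, by simp [g, hn]⟩
    obtain ⟨k, hk⟩ := Nat.rfindOpt_spec ⟨hdom, rfl⟩
    -- The search may stop at another index than the known one; single-valuedness identifies the
    -- values.
    have := huniq _ _ _ (sound _ _ _ hk) hb
    exact this ▸ ⟨hdom, rfl⟩

end RecursivelyEnumerable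

/-! ### Kraft's inequality and dyadic intervals -/

section Kraft

/-- The Kraft inequality for prefix free sets of binary strings. -/
theorem kraft_inequality_of_prefixFree (S : Finset (List Bool))
    (hS : ∀ p ∈ S, ∀ q ∈ S, p <+: q → p = q) :
    ∑ p ∈ S, (1 / 2 : ℝ) ^ p.length ≤ 1 := by
  -- A prefix free set is uniquely decodable, by comparing first codewords, except when it is
  -- `{[]}`; that case is settled directly.
  by_cases hnil : [] ∈ S
  · have : S = {[]} := by
      ext q
      simp only [Finset.mem_singleton]
      exact ⟨fun hq => (hS [] hnil q hq List.nil_prefix).symm, fun h => h ▸ hnil⟩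
    simp [this]
  · have hud : InformationTheory.UniquelyDecodable (S : Set (List Bool)) := by
      intro L₁
      induction L₁ with
      | nil =>
        rintro (_ | ⟨w, L₂⟩) _ h₂ h
        · rfl
        · have hw : w = [] := by
            have h' := h.symm
            simp only [List.flatten_nil, List.flatten_cons, List.append_eq_nil_iff] at h'
            exact h'.1
          exact absurd (hw ▸ h₂ w (by simp)) hnil
      | cons v L₁ ih =>
        rintro (_ | ⟨w, L₂⟩) h₁ h₂ h
        · have hv : v = [] := by
            simp only [List.flatten_nil, List.flatten_cons, List.append_eq_nil_iff] at h
            exact h.1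
          exact absurd (hv ▸ h₁ v (by simp)) hnil
        · simp only [List.flatten_cons] at h
          have hv : v ∈ S := h₁ v (by simp)
          have hw : w ∈ S := h₂ w (by simp)
          have hvw : v = w := by
            rcases List.prefix_or_prefix_of_prefix (List.prefix_append v L₁.flatten)
              (h ▸ List.prefix_append w L₂.flatten) with h' | h'
            · exact hS v hv w hw h'
            · exact (hS w hw v hv h').symm
          subst hvw
          rw [ih L₂ (fun u hu => h₁ u (by simp [hu])) (fun u hu => h₂ u (by simp [hu]))
            (List.append_cancel_left h)]
    simpa using InformationTheory.kraft_mcmillan_inequality hud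

/-- A geometric tail. The exponent `n + 1` lets requests of all lengths `n ≥ L` for one value cost
no more than a single codeword of length `L`. -/
theorem sum_half_pow_succ_le (N : Finset ℕ) (L : ℕ) (hN : ∀ n ∈ N, L ≤ n) :
    ∑ n ∈ N, (1 / 2 : ℝ) ^ (n + 1) ≤ (1 / 2) ^ L := by
  have hgeom : ∀ k, ∑ n ∈ Finset.Ico L (L + k), (1 / 2 : ℝ) ^ (n + 1) =
      (1 / 2) ^ L - (1 / 2) ^ (L + k) := by
    intro k
    induction k with
    | zero => simp
    | succ k ih =>
      rw [← add_assoc, Finset.sum_Ico_succ_top (by omega), ih]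
      ring
  have hsub : N ⊆ Finset.Ico L (L + (N.sup id + 1)) := by
    intro n hn
    have := Finset.le_sup (f := id) hn
    simp only [id, Finset.mem_Ico] at this ⊢
    exact ⟨hN n hn, by omega⟩
  calc _ ≤ ∑ n ∈ Finset.Ico L (L + (N.sup id + 1)), (1 / 2 : ℝ) ^ (n + 1) :=
        Finset.sum_le_sum_of_subset_of_nonneg hsub fun _ _ _ => by positivity
    _ ≤ _ := by
        rw [hgeom]
        have : (0 : ℝ) ≤ (1 / 2) ^ (L + (N.sup id + 1)) := by positivity
        linarith

/-- If a prefix stable relation between programs and values holds for a program of length `n`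
and the value `z` whenever `(n, z) ∈ T`, then the weights `2 ^ (-n - 1)` sum up to at most one. -/
theorem sum_half_pow_succ_le_one_of_prefixStable {γ : Type*} (R : List Bool → γ → Prop)
    (hR : ∀ p q z z', R p z → R q z' → p <+: q → z = z') (T : Finset (ℕ × γ))
    (hT : ∀ r ∈ T, ∃ p : List Bool, p.length = r.1 ∧ R p r.2) :
    ∑ r ∈ T, (1 / 2 : ℝ) ^ (r.1 + 1) ≤ 1 := by
  classical
  -- For each value take a program of the least length occurring in `T`. By stability these programs
  -- form a prefix free set, and each pays for all requests of its value.
  have hmin : ∀ z ∈ T.image Prod.snd, ∃ p : List Bool, R p z ∧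
      ∀ r ∈ T, r.2 = z → p.length ≤ r.1 := by
    intro z hz
    obtain ⟨r₀, hr₀, rfl⟩ := Finset.mem_image.1 hz
    obtain ⟨r, hr, hle⟩ := (T.filter fun r => r.2 = r₀.2).exists_min_image Prod.fst
      ⟨r₀, by simp [hr₀]⟩
    rw [Finset.mem_filter] at hr
    obtain ⟨p, hp, hpR⟩ := hT r hr.1
    exact ⟨p, hr.2 ▸ hpR, fun r' hr' h => hp ▸ hle r' (by simp [hr', h])⟩
  choose! p hpR hple using hmin
  have hinj : Set.InjOn p (T.image Prod.snd) := fun z hz z' hz' h =>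
    hR _ _ _ _ (hpR z hz) (hpR z' hz') (h ▸ List.prefix_rfl)
  calc ∑ r ∈ T, (1 / 2 : ℝ) ^ (r.1 + 1)
      = ∑ z ∈ T.image Prod.snd, ∑ r ∈ T with r.2 = z, (1 / 2 : ℝ) ^ (r.1 + 1) :=
        (Finset.sum_fiberwise_of_maps_to (fun r hr => Finset.mem_image_of_mem _ hr) _).symm
    _ ≤ ∑ z ∈ T.image Prod.snd, (1 / 2 : ℝ) ^ (p z).length := by
        refine Finset.sum_le_sum fun z hz => ?_
        rw [← Finset.sum_image (s := T.filter fun r => r.2 = z) (g := Prod.fst)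
          (f := fun n => (1 / 2 : ℝ) ^ (n + 1))]
        · refine sum_half_pow_succ_le _ _ fun n hn => ?_
          obtain ⟨r, hr, rfl⟩ := Finset.mem_image.1 hn
          rw [Finset.mem_filter] at hr
          exact hple z hz r hr.1 hr.2
        · intro r hr r' hr' h
          simp only [Finset.mem_coe, Finset.mem_filter] at hr hr'
          exact Prod.ext h (hr.2.trans hr'.2.symm)
    _ = ∑ q ∈ (T.image Prod.snd).image p, (1 / 2 : ℝ) ^ q.length :=
        (Finset.sum_image (f := fun q : List Bool => (1 / 2 : ℝ) ^ q.length) hinj).symm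
    _ ≤ 1 := by
        refine kraft_inequality_of_prefixFree _ fun q hq q' hq' h => ?_
        obtain ⟨z, hz, rfl⟩ := Finset.mem_image.1 hq
        obtain ⟨z', hz', rfl⟩ := Finset.mem_image.1 hq'
        rw [hR _ _ _ _ (hpR z hz) (hpR z' hz') h]

/-- The number with binary expansion `q`. -/
def binaryValue (q : List Bool) : ℕ := q.foldl (fun n b => 2 * n + b.toNat) 0

theorem binaryValue_concat (q : List Bool) (b : Bool) :
    binaryValue (q ++ [b]) = 2 * binaryValue q + b.toNat := by
  simp [binaryValue]

/-- Nesting of dyadic intervals: if `q` stands for the interval of length `2 ^ (-ℓ(q))` starting at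
`0.q`, an extension of `q` has its interval inside that of `q`. -/
theorem binaryValue_append_bounds (q r : List Bool) :
    binaryValue q * 2 ^ r.length ≤ binaryValue (q ++ r) ∧
      binaryValue (q ++ r) + 1 ≤ (binaryValue q + 1) * 2 ^ r.length := by
  induction r using List.reverseRecOn with
  | nil => simp
  | append_singleton r b ih =>
    rw [← List.append_assoc, binaryValue_concat, List.length_append, List.length_singleton,
      pow_succ]
    have := b.toNat_le
    constructor <;> nlinarith [ih.1, ih.2]

theorem exists_binaryValue_eq (n k : ℕ) (hk : k < 2 ^ n) :
    ∃ q : List Bool, q.length = n ∧ binaryValue q = k := by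
  induction n generalizing k with
  | zero => exact ⟨[], rfl, by simp at hk; simp [binaryValue, hk]⟩
  | succ n ih =>
    obtain ⟨q, hq, hv⟩ := ih (k / 2) (by rw [pow_succ] at hk; omega)
    refine ⟨q ++ [decide (k % 2 = 1)], by simp [hq], ?_⟩
    rw [binaryValue_concat, hv]
    rcases Nat.mod_two_eq_zero_or_one k with h | h <;> simp [h] <;> omega

theorem primrec_binaryValue : Primrec binaryValue := by
  have hstep : Primrec₂ fun (_ : List Bool) (t : ℕ × Bool) => 2 * t.1 + t.2.toNat :=
    Primrec.nat_add.comp (Primrec.nat_double.comp (Primrec.fst.comp Primrec.snd))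
      ((Primrec.dom_bool Bool.toNat).comp (Primrec.snd.comp Primrec.snd))
  exact Primrec.list_foldl Primrec.id (Primrec.const 0) hstep

end Kraft

/-! ### The Kraft–Chaitin construction -/

section KraftChaitin

variable {β γ : Type*} [Primcodable γ]
  (D : List Bool × β × γ → ℕ → Bool) (y : β)

theorem Primrec₂.nat_pow : Primrec₂ ((· ^ ·) : ℕ → ℕ → ℕ) :=
  Primrec₂.unpaired'.1 Nat.Primrec.pow

/-- The length and the value of the program found at stage `s` of the enumeration with decision
procedure `D`. -/
def kraftCandidate (s : ℕ) : Option (ℕ × γ) :=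
  (Encodable.decode₂ (List Bool × γ) s.unpair.2).bind fun r =>
    if D (r.1, y, r.2) s.unpair.1 = true then some (r.1.length, r.2) else none

open Classical in
/-- The candidate of stage `s`, unless it occurred at an earlier stage. -/
noncomputable def kraftRequest (s : ℕ) : Option (ℕ × γ) :=
  (kraftCandidate D y s).bind fun r =>
    if ∃ i < s, kraftCandidate D y i = some r then none else some r

/-- `2 ^ s` times the total weight of the requests before stage `s`, a request for a codeword of
length `n` having weight `2 ^ (-n - 1)`. -/
noncomputable def kraftSum (s : ℕ) : ℕ :=
  Nat.rec 0 (fun s A => 2 * A + (kraftRequest D y s).elim 0 fun r => 2 ^ (s - r.1)) s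

/-- The interval of `q` lies within the interval allocated at stage `s`. -/
def KraftAllocated (s : ℕ) (q : List Bool) : Prop :=
  kraftSum D y s * 2 ^ q.length ≤ binaryValue q * 2 ^ s ∧
    (binaryValue q + 1) * 2 ^ (s + 1) ≤ kraftSum D y (s + 1) * 2 ^ q.length

/-- `q` is a codeword of `z`. -/
def KraftCodeword (q : List Bool) (z : γ) : Prop :=
  ∃ s n, kraftRequest D y s = some (n, z) ∧ q.length = n + 2 ∧ KraftAllocated D y s q

variable {D} {y}

theorem primrec_kraftCandidate [Primcodable β] (hD : Primrec₂ D) : Primrec₂ (kraftCandidate D) := by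
  refine Primrec.option_bind (Primrec.decode₂.comp (Primrec.snd.comp
    (Primrec.unpair.comp Primrec.snd))) ?_
  refine Primrec.ite (Primrec.primrecPred ?_) (Primrec.option_some.comp
    ((Primrec.list_length.comp (Primrec.fst.comp Primrec.snd)).pair
      (Primrec.snd.comp Primrec.snd))) (Primrec.const _)
  have : Primrec₂ fun (x : β × ℕ) (r : List Bool × γ) => D (r.1, x.1, r.2) x.2.unpair.1 :=
    hD.comp ((Primrec.fst.comp Primrec.snd).pair
      ((Primrec.fst.comp Primrec.fst).pair (Primrec.snd.comp Primrec.snd)))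
      (Primrec.fst.comp (Primrec.unpair.comp (Primrec.snd.comp Primrec.fst)))
  exact Primrec.of_eq this fun _ => by simp

theorem primrec_kraftRequest [Primcodable β] (hD : Primrec₂ D) : Primrec₂ (kraftRequest D) := by
  classical
  refine Primrec.option_bind (primrec_kraftCandidate hD) ?_
  have hrel : PrimrecRel fun (i : ℕ) (t : β × (ℕ × γ)) =>
      kraftCandidate D t.1 i = some t.2 :=
    Primrec.eq.comp ((primrec_kraftCandidate hD).comp (Primrec.fst.comp Primrec.snd) Primrec.fst)
      (Primrec.option_some.comp (Primrec.snd.comp Primrec.snd))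
  have hex : PrimrecPred fun t : (β × ℕ) × (ℕ × γ) =>
      ∃ i < t.1.2, kraftCandidate D t.1.1 i = some t.2 :=
    (PrimrecRel.comp hrel.exists_mem_list (f := fun t : (β × ℕ) × (ℕ × γ) => List.range t.1.2)
      (g := fun t : (β × ℕ) × (ℕ × γ) => (t.1.1, t.2))
      (Primrec.list_range.comp (Primrec.snd.comp Primrec.fst))
      ((Primrec.fst.comp Primrec.fst).pair Primrec.snd)).of_eq (by simp)
  exact Primrec.ite hex (Primrec.const _) (Primrec.option_some.comp Primrec.snd)

theorem primrec_kraftSum [Primcodable β] (hD : Primrec₂ D) : Primrec₂ (kraftSum D) := by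
  have helim : Primrec₂ fun (y : β) (t : ℕ × ℕ) =>
      (kraftRequest D y t.1).elim 0 fun r => 2 ^ (t.1 - r.1) := by
    refine Primrec.of_eq (Primrec.option_casesOn
      (o := fun x : β × (ℕ × ℕ) => kraftRequest D x.1 x.2.1) (f := fun _ => 0)
      (g := fun x r => 2 ^ (x.2.1 - r.1))
      ((primrec_kraftRequest hD).comp Primrec.fst (Primrec.fst.comp Primrec.snd))
      (Primrec.const 0)
      (Primrec₂.nat_pow.comp (Primrec.const 2) (Primrec.nat_sub.comp
        (Primrec.fst.comp (Primrec.snd.comp Primrec.fst)) (Primrec.fst.comp Primrec.snd)))) ?_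
    intro x
    beta_reduce
    cases kraftRequest D x.1 x.2.1 <;> rfl
  have hstep : Primrec₂ fun (y : β) (t : ℕ × ℕ) =>
      2 * t.2 + (kraftRequest D y t.1).elim 0 fun r => 2 ^ (t.1 - r.1) :=
    Primrec.nat_add.comp (Primrec.nat_double.comp (Primrec.snd.comp Primrec.snd)) helim
  exact Primrec.nat_rec (Primrec.const 0) hstep

theorem rePred_kraftCodeword [Primcodable β] (hD : Primrec₂ D) :
    REPred fun t : (List Bool × β) × γ => KraftCodeword D t.1.2 t.1.1 t.2 := by
  refine REPred.exists (p := fun (t : (List Bool × β) × γ) (s : ℕ) =>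
    ∃ n, kraftRequest D t.1.2 s = some (n, t.2) ∧ t.1.1.length = n + 2 ∧
      KraftAllocated D t.1.2 s t.1.1) ?_
  refine REPred.exists (p := fun (t : ((List Bool × β) × γ) × ℕ) (n : ℕ) =>
    kraftRequest D t.1.1.2 t.2 = some (n, t.1.2) ∧ t.1.1.1.length = n + 2 ∧
      KraftAllocated D t.1.1.2 t.2 t.1.1.1) ?_
  have hy : Primrec fun t : (((List Bool × β) × γ) × ℕ) × ℕ => t.1.1.1.2 :=
    Primrec.snd.comp (Primrec.fst.comp (Primrec.fst.comp Primrec.fst))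
  have hq : Primrec fun t : (((List Bool × β) × γ) × ℕ) × ℕ => t.1.1.1.1 :=
    Primrec.fst.comp (Primrec.fst.comp (Primrec.fst.comp Primrec.fst))
  have hz : Primrec fun t : (((List Bool × β) × γ) × ℕ) × ℕ => t.1.1.2 :=
    Primrec.snd.comp (Primrec.fst.comp Primrec.fst)
  have hs : Primrec fun t : (((List Bool × β) × γ) × ℕ) × ℕ => t.1.2 :=
    Primrec.snd.comp Primrec.fst
  have hs' : Primrec fun t : (((List Bool × β) × γ) × ℕ) × ℕ => t.1.2 + 1 :=
    Primrec.succ.comp hs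
  have hlen := Primrec₂.nat_pow.comp (Primrec.const 2) (Primrec.list_length.comp hq)
  refine PrimrecPred.rePred (PrimrecPred.and ?_ (PrimrecPred.and ?_ (PrimrecPred.and ?_ ?_)))
  · exact Primrec.eq.comp ((primrec_kraftRequest hD).comp hy hs)
      (Primrec.option_some.comp (Primrec.snd.pair hz))
  · exact Primrec.eq.comp (Primrec.list_length.comp hq)
      (Primrec.nat_add.comp Primrec.snd (Primrec.const 2))
  · exact Primrec.nat_le.comp
      (Primrec.nat_mul.comp ((primrec_kraftSum hD).comp hy hs) hlen)
      (Primrec.nat_mul.comp (primrec_binaryValue.comp hq)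
        (Primrec₂.nat_pow.comp (Primrec.const 2) hs))
  · exact Primrec.nat_le.comp
      (Primrec.nat_mul.comp (Primrec.succ.comp (primrec_binaryValue.comp hq))
        (Primrec₂.nat_pow.comp (Primrec.const 2) hs'))
      (Primrec.nat_mul.comp ((primrec_kraftSum hD).comp hy hs') hlen)

/-- The bound on the length ensures that the truncated subtraction in `kraftSum` is exact. -/
theorem kraftCandidate_eq_some {s : ℕ} {r : ℕ × γ} (h : kraftCandidate D y s = some r) :
    r.1 ≤ s ∧ ∃ p k, p.length = r.1 ∧ D (p, y, r.2) k = true := by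
  simp only [kraftCandidate, Option.bind_eq_some_iff] at h
  obtain ⟨⟨p, z⟩, hdec, h⟩ := h
  split at h
  · rename_i hD
    cases h
    refine ⟨?_, p, _, rfl, hD⟩
    -- `decode₂` succeeds only on genuine codes, so the code of `p`, and with it the length of `p`,
    -- is bounded by the stage.
    have hs : Nat.pair (Encodable.encode p) (Encodable.encode z) = s.unpair.2 :=
      Encodable.mem_decode₂.1 hdec
    calc p.length ≤ Encodable.encode p := Encodable.length_le_encode p
      _ ≤ s.unpair.2 := hs ▸ Nat.left_le_pair _ _
      _ ≤ s := Nat.unpair_right_le s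
  · cases h

theorem kraftRequest_eq_some {s : ℕ} {r : ℕ × γ} :
    kraftRequest D y s = some r ↔
      kraftCandidate D y s = some r ∧ ∀ i < s, kraftCandidate D y i ≠ some r := by
  simp only [kraftRequest, Option.bind_eq_some_iff]
  constructor
  · rintro ⟨r', h, h'⟩
    split at h'
    · cases h'
    · rename_i hex
      cases h'
      exact ⟨h, fun i hi h => hex ⟨i, hi, h⟩⟩
  · rintro ⟨h, h'⟩
    refine ⟨r, h, if_neg ?_⟩
    rintro ⟨i, hi, h⟩
    exact h' i hi h

theorem kraftRequest_injective {s s' : ℕ} {r : ℕ × γ} (h : kraftRequest D y s = some r)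
    (h' : kraftRequest D y s' = some r) : s = s' := by
  rw [kraftRequest_eq_some] at h h'
  rcases lt_trichotomy s s' with hlt | heq | hlt
  · exact absurd h.1 (h'.2 s hlt)
  · exact heq
  · exact absurd h'.1 (h.2 s' hlt)

theorem exists_kraftRequest {p : List Bool} {z : γ} {k : ℕ} (h : D (p, y, z) k = true) :
    ∃ s, kraftRequest D y s = some (p.length, z) := by
  classical
  have hex : ∃ s, kraftCandidate D y s = some (p.length, z) :=
    ⟨Nat.pair k (Encodable.encode (p, z)), by
      simp [kraftCandidate, -Encodable.encode_prod_val, h]⟩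
  exact ⟨Nat.find hex, kraftRequest_eq_some.2 ⟨Nat.find_spec hex, fun i hi => Nat.find_min hex hi⟩⟩

/-- The total weight of the requests before stage `s`. -/
noncomputable def kraftWeight (D : List Bool × β × γ → ℕ → Bool) (y : β) (s : ℕ) : ℝ :=
  kraftSum D y s / 2 ^ s

theorem kraftWeight_succ (s : ℕ) : kraftWeight D y (s + 1) =
    kraftWeight D y s + (kraftRequest D y s).elim 0 fun r => (1 / 2) ^ (r.1 + 1) := by
  have hrec : kraftSum D y (s + 1) =
    2 * kraftSum D y s + (kraftRequest D y s).elim 0 fun r => 2 ^ (s - r.1) := rfl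
  rw [kraftWeight, kraftWeight, hrec]
  cases h : kraftRequest D y s with
  | none =>
    simp only [Option.elim_none]
    push_cast
    field_simp
    ring
  | some r =>
    have hle := (kraftCandidate_eq_some (kraftRequest_eq_some.1 h).1).1
    obtain ⟨d, rfl⟩ := Nat.exists_eq_add_of_le hle
    simp only [Option.elim_some, Nat.add_sub_cancel_left]
    push_cast
    rw [one_div, inv_pow]
    field_simp
    ring

theorem kraftWeight_mono : Monotone (kraftWeight D y) := by
  refine monotone_nat_of_le_succ fun s => ?_
  rw [kraftWeight_succ]
  cases kraftRequest D y s with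
  | none => simp
  | some r => simp

/-- No request is repeated, so the accumulated weight is a sum over a set of requests, to which the
Kraft bound for stable relations applies. -/
theorem exists_kraftWeight_eq_sum (s : ℕ) : ∃ T : Finset (ℕ × γ),
    (∀ r ∈ T, ∃ i < s, kraftRequest D y i = some r) ∧
      kraftWeight D y s = ∑ r ∈ T, (1 / 2 : ℝ) ^ (r.1 + 1) := by
  classical
  induction s with
  | zero => exact ⟨∅, by simp, by simp [kraftWeight, kraftSum]⟩
  | succ s ih =>
    obtain ⟨T, hT, hsum⟩ := ih
    rw [kraftWeight_succ]
    cases h : kraftRequest D y s with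
    | none =>
      refine ⟨T, fun r hr => ?_, by simp [hsum]⟩
      obtain ⟨i, hi, h⟩ := hT r hr
      exact ⟨i, by omega, h⟩
    | some r =>
      have hr : r ∉ T := fun hr => by
        obtain ⟨i, hi, h'⟩ := hT r hr
        exact absurd (kraftRequest_injective h h') (by omega)
      refine ⟨insert r T, fun r' hr' => ?_, ?_⟩
      · rcases Finset.mem_insert.1 hr' with rfl | hr'
        · exact ⟨s, by omega, h⟩
        · obtain ⟨i, hi, h⟩ := hT r' hr'
          exact ⟨i, by omega, h⟩
      · rw [Finset.sum_insert hr, hsum, add_comm]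
        rfl

theorem kraftWeight_le_one
    (hD : ∀ p q z z' k k', D (p, y, z) k = true → D (q, y, z') k' = true → p <+: q → z = z')
    (s : ℕ) : kraftWeight D y s ≤ 1 := by
  obtain ⟨T, hT, hsum⟩ := exists_kraftWeight_eq_sum (D := D) (y := y) s
  rw [hsum]
  refine sum_half_pow_succ_le_one_of_prefixStable (fun p z => ∃ k, D (p, y, z) k = true)
    (fun p q z z' ⟨k, h⟩ ⟨k', h'⟩ => hD p q z z' k k' h h') T fun r hr => ?_
  obtain ⟨i, _, h⟩ := hT r hr
  obtain ⟨_, p, k, hp, hk⟩ := kraftCandidate_eq_some (kraftRequest_eq_some.1 h).1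
  exact ⟨p, hp, k, hk⟩

theorem kraftAllocated_iff {s : ℕ} {q : List Bool} : KraftAllocated D y s q ↔
    kraftWeight D y s ≤ (binaryValue q : ℝ) / 2 ^ q.length ∧
      ((binaryValue q : ℝ) + 1) / 2 ^ q.length ≤ kraftWeight D y (s + 1) := by
  rw [KraftAllocated, kraftWeight, kraftWeight, div_le_div_iff₀ (by positivity) (by positivity),
    div_le_div_iff₀ (by positivity) (by positivity)]
  norm_cast

/-- This is where the two extra bits come from. The request allocates an interval of length `2 ^ (-n
- 1)`, twice the mesh of the dyadic grid of level `n + 2`, so it contains a full grid interval. The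
total weight is at most one, so that interval is the interval of a string. -/
theorem exists_kraftCodeword
    (hD : ∀ p q z z' k k', D (p, y, z) k = true → D (q, y, z') k' = true → p <+: q → z = z')
    {p : List Bool} {z : γ} {k : ℕ} (h : D (p, y, z) k = true) :
    ∃ q, q.length = p.length + 2 ∧ KraftCodeword D y q z := by
  obtain ⟨s, hs⟩ := exists_kraftRequest h
  have hsucc := kraftWeight_succ (D := D) (y := y) s
  rw [hs, Option.elim_some] at hsucc
  have hone := kraftWeight_le_one hD (s + 1)
  set W := kraftWeight D y s with hW
  have hW0 : 0 ≤ W := by rw [hW, kraftWeight]; positivity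
  set P : ℝ := 2 ^ (p.length + 2) with hP
  have hP0 : 0 < P := by positivity
  have hmul : kraftWeight D y (s + 1) * P = W * P + 2 := by
    rw [hsucc, add_mul, hP, one_div, inv_pow]
    field_simp
    ring
  have hceil := Nat.ceil_lt_add_one (mul_nonneg hW0 hP0.le)
  have hub : (⌈W * P⌉₊ : ℝ) + 1 ≤ kraftWeight D y (s + 1) * P := by linarith
  have hlt : ⌈W * P⌉₊ < 2 ^ (p.length + 2) := by
    have : (⌈W * P⌉₊ : ℝ) < 2 ^ (p.length + 2) := by nlinarith
    exact_mod_cast this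
  obtain ⟨q, hq, hv⟩ := exists_binaryValue_eq _ _ hlt
  refine ⟨q, hq, s, _, hs, hq, kraftAllocated_iff.2 ?_⟩
  rw [hq, hv, ← hP, le_div_iff₀ hP0, div_le_iff₀ hP0]
  exact ⟨Nat.le_ceil _, hub⟩

/-- The interval of `q'` is nested in that of `q`, while different stages own intervals without
common interior. Hence the stages agree, and one stage fixes both the value and the codeword length.
-/
theorem kraftCodeword_prefixFree {q q' : List Bool} {z z' : γ} (h : KraftCodeword D y q z)
    (h' : KraftCodeword D y q' z') (hqq : q <+: q') : q = q' ∧ z = z' := by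
  obtain ⟨s, n, hs, hn, ha⟩ := h
  obtain ⟨s', n', hs', hn', ha'⟩ := h'
  obtain ⟨r, rfl⟩ := hqq
  rw [kraftAllocated_iff] at ha ha'
  obtain ⟨h₁, h₂⟩ := binaryValue_append_bounds q r
  have hlo : (binaryValue q : ℝ) / 2 ^ q.length ≤
      (binaryValue (q ++ r) : ℝ) / 2 ^ (q ++ r).length := by
    rw [div_le_div_iff₀ (by positivity) (by positivity), List.length_append, pow_add]
    have : (binaryValue q : ℝ) * 2 ^ r.length ≤ binaryValue (q ++ r) := by exact_mod_cast h₁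
    nlinarith [pow_pos (two_pos : (0 : ℝ) < 2) q.length]
  have hhi : ((binaryValue (q ++ r) : ℝ) + 1) / 2 ^ (q ++ r).length ≤
      ((binaryValue q : ℝ) + 1) / 2 ^ q.length := by
    rw [div_le_div_iff₀ (by positivity) (by positivity), List.length_append, pow_add]
    have : (binaryValue (q ++ r) : ℝ) + 1 ≤ (binaryValue q + 1) * 2 ^ r.length := by
      exact_mod_cast h₂
    nlinarith [pow_pos (two_pos : (0 : ℝ) < 2) q.length]
  have hpos : (binaryValue (q ++ r) : ℝ) / 2 ^ (q ++ r).length <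
      ((binaryValue (q ++ r) : ℝ) + 1) / 2 ^ (q ++ r).length := by
    gcongr
    linarith
  rcases lt_trichotomy s s' with hlt | rfl | hlt
  · have := kraftWeight_mono (D := D) (y := y) (Nat.succ_le_of_lt hlt)
    simp only [Nat.succ_eq_add_one] at this
    linarith [ha.2, ha'.1]
  · rw [hs] at hs'
    cases hs'
    refine ⟨?_, rfl⟩
    have : r.length = 0 := by
      rw [List.length_append] at hn'
      omega
    rw [List.length_eq_zero_iff.1 this, List.append_nil]
  · have := kraftWeight_mono (D := D) (y := y) (Nat.succ_le_of_lt hlt)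
    simp only [Nat.succ_eq_add_one] at this
    linarith [ha.1, ha'.2]

/-- **Kraft–Chaitin theorem**: an enumerable prefix stable relation has a prefix free enumerable
counterpart whose programs are at most two bits longer. -/
theorem exists_prefixFree_of_prefixStable [Primcodable β] {E : List Bool → β → γ → Prop}
    (hE : REPred fun t : List Bool × β × γ => E t.1 t.2.1 t.2.2)
    (hstable : ∀ p q y z z', E p y z → E q y z' → p <+: q → z = z') :
    ∃ R : List Bool → β → γ → Prop,
      (REPred fun t : (List Bool × β) × γ => R t.1.1 t.1.2 t.2) ∧
      (∀ p q y z z', R p y z → R q y z' → p <+: q → p = q ∧ z = z') ∧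
      ∀ p y z, E p y z → ∃ q, q.length = p.length + 2 ∧ R q y z := by
  obtain ⟨D, hD, h⟩ := hE.exists_primrec_stage
  refine ⟨fun q y z => KraftCodeword D y q z, rePred_kraftCodeword hD,
    fun p q y z z' => kraftCodeword_prefixFree, fun p y z hp => ?_⟩
  obtain ⟨k, hk⟩ := (h (p, y, z)).1 hp
  exact exists_kraftCodeword (fun p q z z' k k' hp hq =>
    hstable p q y z z' ((h (p, y, z)).2 ⟨k, hp⟩) ((h (q, y, z')).2 ⟨k', hq⟩)) hk

end KraftChaitin

/-! ### Runs of twice prefix machines -/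

namespace TwicePrefixMachine

/-- The rest of the two tapes and the portions that have been read. -/
abbrev RunState (X : Type*) := (List Bool × List X) × (List Bool × List X)

/-- The effect of an action: the output together with the portions read, or the next state,
or nothing if a tape is exhausted. -/
def actionEffect {X : Type*} (s : RunState X) (a : TapeAction X) :
    Option ((List X × (List Bool × List X)) ⊕ RunState X) :=
  match a with
  | Sum.inl false => s.1.1.head?.map fun b =>
      Sum.inr ((s.1.1.tail, s.1.2), (s.2.1 ++ [b], s.2.2))
  | Sum.inl true => s.1.2.head?.map fun c =>
      Sum.inr ((s.1.1, s.1.2.tail), (s.2.1, s.2.2 ++ [c]))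
  | Sum.inr z => some (Sum.inl (z, s.2))

/-- The match is rewritten with the eliminators for which primitive recursiveness is available. -/
theorem actionEffect_eq {X : Type*} (s : RunState X) (a : TapeAction X) : actionEffect s a =
    Sum.casesOn a
      (fun c => cond c
        (s.1.2.head?.map fun c => Sum.inr ((s.1.1, s.1.2.tail), (s.2.1, s.2.2 ++ [c])))
        (s.1.1.head?.map fun b => Sum.inr ((s.1.1.tail, s.1.2), (s.2.1 ++ [b], s.2.2))))
      (fun z => some (Sum.inl (z, s.2))) := by
  rcases a with (_ | _) | z <;> rfl

variable {X : Type*} [Primcodable X] (T : TwicePrefixMachine X)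

theorem primrec_actionEffect : Primrec₂ (actionEffect (X := X)) := by
  have hread : Primrec₂ fun (t : RunState X × TapeAction X) (c : Bool) => cond c
      (t.1.1.2.head?.map fun c => (Sum.inr ((t.1.1.1, t.1.1.2.tail), (t.1.2.1, t.1.2.2 ++ [c])) :
        (List X × (List Bool × List X)) ⊕ RunState X))
      (t.1.1.1.head?.map fun b => Sum.inr ((t.1.1.1.tail, t.1.1.2), (t.1.2.1 ++ [b], t.1.2.2))) := by
    have hrest : Primrec fun u : (RunState X × TapeAction X) × Bool => u.1.1.1 :=
      Primrec.fst.comp (Primrec.fst.comp Primrec.fst)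
    have hdone : Primrec fun u : (RunState X × TapeAction X) × Bool => u.1.1.2 :=
      Primrec.snd.comp (Primrec.fst.comp Primrec.fst)
    refine Primrec.cond Primrec.snd ?_ ?_
    · refine Primrec.option_map (Primrec.list_head?.comp (Primrec.snd.comp hrest)) ?_
      refine Primrec.sumInr.comp (Primrec.pair (Primrec.pair ?_ ?_) (Primrec.pair ?_ ?_))
      · exact (Primrec.fst.comp hrest).comp Primrec.fst
      · exact (Primrec.list_tail.comp (Primrec.snd.comp hrest)).comp Primrec.fst
      · exact (Primrec.fst.comp hdone).comp Primrec.fst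
      · exact Primrec.list_concat.comp ((Primrec.snd.comp hdone).comp Primrec.fst) Primrec.snd
    · refine Primrec.option_map (Primrec.list_head?.comp (Primrec.fst.comp hrest)) ?_
      refine Primrec.sumInr.comp (Primrec.pair (Primrec.pair ?_ ?_) (Primrec.pair ?_ ?_))
      · exact (Primrec.list_tail.comp (Primrec.fst.comp hrest)).comp Primrec.fst
      · exact (Primrec.snd.comp hrest).comp Primrec.fst
      · exact Primrec.list_concat.comp ((Primrec.fst.comp hdone).comp Primrec.fst) Primrec.snd
      · exact (Primrec.snd.comp hdone).comp Primrec.fst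
  have hhalt : Primrec₂ fun (t : RunState X × TapeAction X) (z : List X) =>
      (some (Sum.inl (z, t.1.2)) : Option ((List X × (List Bool × List X)) ⊕ RunState X)) :=
    Primrec.option_some.comp (Primrec.sumInl.comp
      (Primrec.snd.pair (Primrec.snd.comp (Primrec.fst.comp Primrec.fst))))
  exact Primrec.of_eq (Primrec.sumCasesOn Primrec.snd hread hhalt)
    fun t => (actionEffect_eq t.1 t.2).symm

/-- One step of the machine. -/
def runStep (s : RunState X) : Part ((List X × (List Bool × List X)) ⊕ RunState X) :=
  (T.next s.2).bind fun a => (actionEffect s a : Part _)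

theorem partrec_runStep : Partrec T.runStep :=
  (T.partrec.comp Computable.snd).bind primrec_actionEffect.to_comp.ofOption

theorem mem_runStep {s : RunState X} {r} :
    r ∈ T.runStep s ↔ ∃ a ∈ T.next s.2, actionEffect s a = some r := by
  simp [runStep]

theorem inl_mem_runStep {s : RunState X} {z : List X} {w : List Bool × List X} :
    Sum.inl (z, w) ∈ T.runStep s ↔ TapeAction.halt z ∈ T.next s.2 ∧ w = s.2 := by
  rw [mem_runStep]
  constructor
  · rintro ⟨(_ | _) | z, ha, h⟩ <;> simp [actionEffect] at h
    obtain ⟨rfl, rfl⟩ := h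
    exact ⟨ha, rfl⟩
  · rintro ⟨h, rfl⟩
    exact ⟨_, h, rfl⟩

theorem inr_mem_runStep {s s' : RunState X} : Sum.inr s' ∈ T.runStep s ↔
    (TapeAction.readProgram ∈ T.next s.2 ∧ ∃ b p, s.1.1 = b :: p ∧
      s' = ((p, s.1.2), (s.2.1 ++ [b], s.2.2))) ∨
    (TapeAction.readCondition ∈ T.next s.2 ∧ ∃ c x, s.1.2 = c :: x ∧
      s' = ((s.1.1, x), (s.2.1, s.2.2 ++ [c]))) := by
  obtain ⟨⟨p, x⟩, q, y⟩ := s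
  rw [mem_runStep]
  constructor
  · rintro ⟨(_ | _) | z, ha, h⟩
    · cases p with
      | nil => simp [actionEffect] at h
      | cons b p =>
        simp only [actionEffect, List.head?_cons, Option.map_some, List.tail_cons,
          Option.some.injEq, Sum.inr.injEq] at h
        exact Or.inl ⟨ha, b, p, rfl, h.symm⟩
    · cases x with
      | nil => simp [actionEffect] at h
      | cons c x =>
        simp only [actionEffect, List.head?_cons, Option.map_some, List.tail_cons,
          Option.some.injEq, Sum.inr.injEq] at h
        exact Or.inr ⟨ha, c, x, rfl, h.symm⟩
    · simp [actionEffect] at h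
  · rintro (⟨ha, b, p', h, rfl⟩ | ⟨ha, c, x', h, rfl⟩)
    · simp only at h
      subst h
      exact ⟨_, ha, rfl⟩
    · simp only at h
      subst h
      exact ⟨_, ha, rfl⟩

/-- The run of the machine on tapes with the given contents: the output together with the
portions of the tapes that have been read. -/
def run : List Bool × List X →. List X × (List Bool × List X) := fun t =>
  PFun.fix T.runStep (t, ([], []))

theorem partrec_run : Partrec T.run :=
  (Partrec.fix T.partrec_runStep).comp (Computable.id.pair (Computable.const ([], [])))

/-- On each tape, the portion read followed by the rest is invariant along the run. -/
theorem outputs_of_mem_fix {s : RunState X} {z : List X} {p₀ : List Bool} {x₀ : List X}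
    (h : (z, (p₀, x₀)) ∈ PFun.fix T.runStep s) (hs : T.Reads s.2.1 s.2.2) :
    T.Outputs p₀ x₀ z ∧ p₀ <+: s.2.1 ++ s.1.1 ∧ x₀ <+: s.2.2 ++ s.1.2 := by
  revert hs
  refine PFun.fixInduction' h ?_ ?_
  · intro s hs hr
    obtain ⟨hz, hw⟩ := T.inl_mem_runStep.1 hs
    obtain ⟨⟨p, x⟩, q, y⟩ := s
    cases hw
    exact ⟨⟨hr, hz⟩, by simp, by simp⟩
  · intro s s' _ hs ih hr
    obtain ⟨⟨p, x⟩, q, y⟩ := s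
    rcases T.inr_mem_runStep.1 hs with ⟨ha, b, p', hp, rfl⟩ | ⟨ha, c, x', hx, rfl⟩
    · simp only at hp
      subst hp
      simpa using ih (Reads.readProgram _ _ b hr ha)
    · simp only at hx
      subst hx
      simpa using ih (Reads.readCondition _ _ c hr ha)

/-- Induction backwards along the run: undoing a step pushes the last symbol read back onto the rest
of its tape, which is why `p` and `x` are generalized. -/
theorem mem_fix_of_reads {q : List Bool} {y : List X} (h : T.Reads q y) (p : List Bool)
    (x : List X) {r} (hr : r ∈ PFun.fix T.runStep ((p, x), (q, y))) :
    r ∈ T.run (q ++ p, y ++ x) := by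
  induction h generalizing p x with
  | start => exact hr
  | readProgram q y b _ ha ih =>
    simpa using ih (b :: p) x (PFun.mem_fix_iff.2 (Or.inr ⟨_,
      T.inr_mem_runStep.2 (Or.inl ⟨ha, b, p, rfl, rfl⟩), hr⟩))
  | readCondition q y c _ ha ih =>
    simpa using ih p (c :: x) (PFun.mem_fix_iff.2 (Or.inr ⟨_,
      T.inr_mem_runStep.2 (Or.inr ⟨ha, c, x, rfl, rfl⟩), hr⟩))

theorem mem_run_iff {p p₀ : List Bool} {x x₀ z : List X} : (z, (p₀, x₀)) ∈ T.run (p, x) ↔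
    T.Outputs p₀ x₀ z ∧ p₀ <+: p ∧ x₀ <+: x := by
  constructor
  · intro h
    simpa using T.outputs_of_mem_fix h Reads.start
  · rintro ⟨⟨hr, hz⟩, ⟨p', rfl⟩, ⟨x', rfl⟩⟩
    exact T.mem_fix_of_reads hr p' x' (PFun.mem_fix_iff.2 (Or.inl
      (T.inl_mem_runStep.2 ⟨hz, rfl⟩)))

/-- The triples `(p, x, z)` such that the machine prints `z` having read prefixes of `p`
and `x`. -/
def outputSet : Set (List Bool × List X × List X) :=
  {t | ∃ p₀ x₀, T.Outputs p₀ x₀ t.2.2 ∧ p₀ <+: t.1 ∧ x₀ <+: t.2.1}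

/-- Everything follows from determinism: on given tapes, the output and both portions read are
unique. -/
theorem isKStarCorrect_outputSet : IsKStarCorrect T.outputSet where
  enumerable := by
    have hgraph : REPred fun u : (List Bool × List X × List X) × (List Bool × List X) =>
        (u.1.2.2, u.2) ∈ T.run (u.1.1, u.1.2.1) :=
      T.partrec_run.rePred_mem
        (Primrec.pair (Primrec.fst.comp Primrec.fst)
          (Primrec.fst.comp (Primrec.snd.comp Primrec.fst))).to_comp
        (Primrec.pair (Primrec.snd.comp (Primrec.snd.comp Primrec.fst)) Primrec.snd).to_comp
    refine (REPred.exists (p := fun (t : List Bool × List X × List X) (w : List Bool × List X) =>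
      (t.2.2, w) ∈ T.run (t.1, t.2.1)) hgraph).of_eq fun t => ?_
    simp only [Prod.exists, mem_run_iff]
    rfl
  singleValued := by
    rintro p x z z' ⟨p₀, x₀, h⟩ ⟨p₁, x₁, h'⟩
    exact congrArg Prod.fst (Part.mem_unique (T.mem_run_iff.2 h) (T.mem_run_iff.2 h'))
  prolong := by
    rintro p p' x x' z ⟨p₀, x₀, h, hp, hx⟩ hpp hxx
    exact ⟨p₀, x₀, h, hp.trans hpp, hx.trans hxx⟩
  meet := by
    rintro p p' x x' z ⟨p₀, x₀, h, hp, hx⟩ ⟨p₁, x₁, h', hp', hx'⟩ hpp hxx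
    -- Both runs are compared on the longer tapes `p'` and `x'`. They read the same portions, so the
    -- program portion lies in `p` and the condition portion in `x`.
    have heq := Part.mem_unique (T.mem_run_iff.2 ⟨h, hp.trans hpp, hx⟩)
      (T.mem_run_iff.2 ⟨h', hp', hx'.trans hxx⟩)
    cases heq
    exact ⟨p₀, x₀, h, hp, hx'⟩

theorem setComplexity_outputSet (z x : List X) :
    setComplexity T.outputSet z x = T.complexity z x := by
  apply le_antisymm
  · refine le_iInf₂ fun p ⟨k, _, h⟩ => iInf₂_le_of_le p ?_ le_rfl
    exact ⟨p, _, h, List.prefix_rfl, List.take_prefix _ _⟩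
  · refine le_iInf₂ fun p ⟨p₀, x₀, h, hp, hx⟩ => iInf₂_le_of_le p₀ ?_ ?_
    · exact ⟨x₀.length, hx.length_le, by rwa [← List.prefix_iff_eq_take.1 hx]⟩
    · exact_mod_cast hp.length_le

variable {T}

theorem Reads.append_program {p w : List Bool} {x : List X} (h : T.Reads p x)
    (hw : ∀ q r, w = q ++ r → r ≠ [] → TapeAction.readProgram ∈ T.next (p ++ q, x)) :
    T.Reads (p ++ w) x := by
  induction w using List.reverseRecOn with
  | nil => simpa using h
  | append_singleton w b ih =>
    rw [← List.append_assoc]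
    refine Reads.readProgram _ _ b (ih fun q r hqr hr => ?_) (hw w [b] rfl (by simp))
    exact hw q (r ++ [b]) (by simp [hqr]) (by simp)

theorem Reads.append_condition {p : List Bool} {x w : List X} (h : T.Reads p x)
    (hw : ∀ q r, w = q ++ r → r ≠ [] → TapeAction.readCondition ∈ T.next (p, x ++ q)) :
    T.Reads p (x ++ w) := by
  induction w using List.reverseRecOn with
  | nil => simpa using h
  | append_singleton w b ih =>
    rw [← List.append_assoc]
    refine Reads.readCondition _ _ b (ih fun q r hqr hr => ?_) (hw w [b] rfl (by simp))
    exact hw q (r ++ [b]) (by simp [hqr]) (by simp)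

end TwicePrefixMachine

/-- A single valued enumerable relation is the transition relation of a twice prefix machine. -/
theorem exists_twicePrefixMachine {X : Type*} [Primcodable X]
    {R : List Bool → List X → TapeAction X → Prop}
    (hR : REPred fun t : (List Bool × List X) × TapeAction X => R t.1.1 t.1.2 t.2)
    (huniq : ∀ p x a a', R p x a → R p x a' → a = a') :
    ∃ T : TwicePrefixMachine X, ∀ p x a, a ∈ T.next (p, x) ↔ R p x a := by
  obtain ⟨f, hf, h⟩ := REPred.exists_partrec (R := fun t : List Bool × List X => R t.1 t.2) hR
    fun t => huniq t.1 t.2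
  exact ⟨⟨f, hf⟩, fun p x => h (p, x)⟩

/-! ### Facts common to the three definitions of `K_*` -/

theorem setComplexity_le {X : Type*} {E : Set (List Bool × List X × List X)} {p : List Bool}
    {x y : List X} (h : (p, x, y) ∈ E) : setComplexity E y x ≤ p.length :=
  iInf₂_le p h

theorem TwicePrefixMachine.complexity_le {X : Type*} [Primcodable X] {T : TwicePrefixMachine X}
    {p : List Bool} {x₀ x z : List X} (h : T.Outputs p x₀ z) (hx : x₀ <+: x) :
    T.complexity z x ≤ p.length := by
  rw [← T.setComplexity_outputSet]
  exact setComplexity_le ⟨p, x₀, h, List.prefix_rfl, hx⟩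

/-- Source of all lower bounds for `K_*`: condition (3) and optimality play no role in them. -/
theorem IsKStar.exists_set {X : Type*} [Primcodable X] {C : List X → List X → ℕ∞}
    (hC : IsKStar C) :
    ∃ E : Set (List Bool × List X × List X), IsWeaklyKStarCorrect E ∧ C = setComplexity E := by
  rcases hC with ⟨U, _, rfl⟩ | ⟨E, hE, rfl⟩ | ⟨E, hE, rfl⟩
  · refine ⟨U.outputSet, U.isKStarCorrect_outputSet.toIsWeaklyKStarCorrect, ?_⟩
    funext z x
    exact (U.setComplexity_outputSet z x).symm
  · exact ⟨E, hE.1.toIsWeaklyKStarCorrect, rfl⟩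
  · exact ⟨E, hE.1, rfl⟩

/-- Source of all upper bounds for `K_*`: the output set of a machine belongs to both classes of
sets. -/
theorem IsKStar.le_complexity {X : Type*} [Primcodable X] {C : List X → List X → ℕ∞}
    (hC : IsKStar C) (T : TwicePrefixMachine X) :
    ∃ c : ℕ, ∀ z x, C z x ≤ T.complexity z x + c := by
  rcases hC with ⟨U, hU, rfl⟩ | ⟨E, hE, rfl⟩ | ⟨E, hE, rfl⟩
  · exact hU T
  · obtain ⟨c, hc⟩ := hE.2 _ T.isKStarCorrect_outputSet
    exact ⟨c, fun z x => T.setComplexity_outputSet z x ▸ hc z x⟩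
  · obtain ⟨c, hc⟩ := hE.2 _ T.isKStarCorrect_outputSet.toIsWeaklyKStarCorrect
    exact ⟨c, fun z x => T.setComplexity_outputSet z x ▸ hc z x⟩

theorem le_iInf_length_add {P : List Bool → Prop} {A c : ℕ∞}
    (h : ∀ p, P p → A ≤ p.length + c) : A ≤ (⨅ (p : List Bool) (_ : P p), (p.length : ℕ∞)) + c :=
  tsub_le_iff_right.1 (le_iInf₂ fun p hp => tsub_le_iff_right.2 (h p hp))

theorem Primrec.list_replicate {α : Type*} [Primcodable α] (a : α) :
    Primrec fun n : ℕ => List.replicate n a :=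
  (Primrec.list_map Primrec.list_range (Primrec.const a).to₂).of_eq fun n => by simp

theorem prefixComplexity_le {X : Type*} {U : List Bool × List X →. List X}
    {p : List Bool} {x y : List X} (h : x ∈ U (p, y)) :
    prefixComplexity U x y ≤ p.length :=
  iInf₂_le p h

/-! ### Bounding prefix complexity by enumerable relations -/

section PrefixMachine

variable {X : Type*} [Primcodable X] {U : List Bool × List X →. List X}

theorem IsPrefixMachine.eq_of_prefix (hU : IsPrefixMachine U) {p q : List Bool} {y w w' : List X}
    (hw : w ∈ U (p, y)) (hw' : w' ∈ U (q, y)) (h : p <+: q) : p = q ∧ w = w' := by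
  obtain rfl := hU.2 y p q (Part.dom_iff_mem.2 ⟨w, hw⟩) (Part.dom_iff_mem.2 ⟨w', hw'⟩) h
  exact ⟨rfl, Part.mem_unique hw hw'⟩

theorem IsPrefixMachine.eq_of_append_eq (hU : IsPrefixMachine U) {p p' r r' : List Bool}
    {y w w' : List X} (hw : w ∈ U (p, y)) (hw' : w' ∈ U (p', y)) (h : p ++ r = p' ++ r') :
    p = p' ∧ r = r' ∧ w = w' := by
  have hp : p = p' ∧ w = w' := by
    rcases List.prefix_or_prefix_of_prefix (List.prefix_append p r)
      (h ▸ List.prefix_append p' r') with h' | h'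
    · exact hU.eq_of_prefix hw hw' h'
    · exact (hU.eq_of_prefix hw' hw h').imp Eq.symm Eq.symm
  obtain ⟨rfl, rfl⟩ := hp
  exact ⟨rfl, List.append_cancel_left h, rfl⟩

theorem IsOptimalPrefixMachine.le_of_prefixFree (hU : IsOptimalPrefixMachine U)
    {R : List Bool → List X → List X → Prop}
    (hR : REPred fun t : (List Bool × List X) × List X => R t.1.1 t.1.2 t.2)
    (hfree : ∀ p q y z z', R p y z → R q y z' → p <+: q → p = q ∧ z = z') :
    ∃ c : ℕ, ∀ p y z, R p y z → prefixComplexity U z y ≤ p.length + c := by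
  obtain ⟨V, hV, h⟩ := REPred.exists_partrec (R := fun t : List Bool × List X => R t.1 t.2) hR
    fun t z z' hz hz' => (hfree _ _ _ _ _ hz hz' List.prefix_rfl).2
  have hVp : IsPrefixMachine V := by
    refine ⟨hV, fun y p q hp hq hpq => ?_⟩
    obtain ⟨z, hz⟩ := Part.dom_iff_mem.1 hp
    obtain ⟨z', hz'⟩ := Part.dom_iff_mem.1 hq
    exact (hfree p q y z z' ((h _ _).1 hz) ((h _ _).1 hz') hpq).1
  obtain ⟨c, hc⟩ := hU.2 V hVp
  refine ⟨c, fun p y z hp => (hc z y).trans ?_⟩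
  gcongr
  exact prefixComplexity_le ((h (p, y) z).2 hp)

theorem IsOptimalPrefixMachine.le_of_prefixStable (hU : IsOptimalPrefixMachine U)
    {E : List Bool → List X → List X → Prop}
    (hE : REPred fun t : List Bool × List X × List X => E t.1 t.2.1 t.2.2)
    (hstable : ∀ p q y z z', E p y z → E q y z' → p <+: q → z = z') :
    ∃ c : ℕ, ∀ p y z, E p y z → prefixComplexity U z y ≤ p.length + c := by
  obtain ⟨R, hR, hfree, hER⟩ := exists_prefixFree_of_prefixStable hE hstable
  obtain ⟨c, hc⟩ := hU.le_of_prefixFree hR hfree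
  refine ⟨2 + c, fun p y z hp => ?_⟩
  obtain ⟨q, hq, hqR⟩ := hER p y z hp
  have := hc q y z hqR
  rw [hq] at this
  push_cast at this ⊢
  rwa [← add_assoc]

/-- For a fixed condition, membership survives prolonging the program, so single-valuedness makes
comparable programs agree. -/
theorem IsOptimalPrefixMachine.le_setComplexity (hU : IsOptimalPrefixMachine U)
    {E : Set (List Bool × List X × List X)} (hE : IsWeaklyKStarCorrect E) :
    ∃ c : ℕ, ∀ x y, prefixComplexity U x y ≤ setComplexity E x y + c := by
  obtain ⟨c, hc⟩ := hU.le_of_prefixStable (E := fun p y z => (p, y, z) ∈ E) hE.enumerable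
    fun p q y z z' hp hq hpq =>
      hE.singleValued q y z z' (hE.prolong p q y y z hp hpq List.prefix_rfl) hq
  exact ⟨c, fun x y => le_iInf_length_add fun p hp => hc p y x hp⟩

/-- A condition `aⁿ` that has to be read without knowing its end does not help. -/
theorem IsOptimalPrefixMachine.le_setComplexity_replicate (hU : IsOptimalPrefixMachine U)
    {E : Set (List Bool × List X × List X)} (hE : IsWeaklyKStarCorrect E) (a : X) :
    ∃ c : ℕ, ∀ x n, prefixComplexity U x [] ≤ setComplexity E x (List.replicate n a) + c := by
  have hre : REPred fun t : List Bool × List X × List X =>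
      ∃ n, (t.1, List.replicate n a, t.2.2) ∈ E :=
    REPred.exists (p := fun (t : List Bool × List X × List X) (n : ℕ) =>
      (t.1, List.replicate n a, t.2.2) ∈ E) (hE.enumerable.comp
        (Primrec.pair (Primrec.fst.comp Primrec.fst)
          (Primrec.pair ((Primrec.list_replicate a).comp Primrec.snd)
            (Primrec.snd.comp (Primrec.snd.comp Primrec.fst)))).to_comp)
  obtain ⟨c, hc⟩ := hU.le_of_prefixStable
    (E := fun p _ z => ∃ n, (p, List.replicate n a, z) ∈ E) hre (by
      rintro p q y z z' ⟨n, hp⟩ ⟨m, hq⟩ hpq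
      -- Two conditions `aⁿ` and `aᵐ` have the common prolongation `aⁿ⁺ᵐ`, where single-valuedness
      -- applies. So quantifying the condition away keeps the relation stable.
      have hmono : ∀ k l : ℕ, List.replicate k a <+: List.replicate (k + l) a := fun k l =>
        ⟨List.replicate l a, by simp⟩
      exact hE.singleValued q (List.replicate (n + m) a) z z'
        (hE.prolong _ _ _ _ _ hp hpq (hmono n m))
        (hE.prolong _ _ _ _ _ hq List.prefix_rfl (add_comm m n ▸ hmono m n)))
  exact ⟨c, fun x n => le_iInf_length_add fun p hp => hc p [] x ⟨n, hp⟩⟩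

/-- When the condition determines the value effectively, the empty program suffices. -/
theorem IsOptimalPrefixMachine.exists_le_of_single_program (hU : IsOptimalPrefixMachine U)
    {R : List X → List X → Prop} (hR : REPred fun t : List X × List X => R t.1 t.2)
    (huniq : ∀ y z z', R y z → R y z' → z = z') :
    ∃ c : ℕ, ∀ y z, R y z → prefixComplexity U z y ≤ c := by
  obtain ⟨c, hc⟩ := hU.le_of_prefixFree (R := fun p y z => p = [] ∧ R y z)
    (REPred.and (PrimrecPred.rePred (Primrec.eq.comp (Primrec.fst.comp Primrec.fst)
        (Primrec.const [])))
      (hR.comp (Primrec.pair (Primrec.snd.comp Primrec.fst) Primrec.snd).to_comp))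
    (by
      rintro p q y z z' ⟨rfl, hz⟩ ⟨rfl, hz'⟩ _
      exact ⟨rfl, huniq _ _ _ hz hz'⟩)
  exact ⟨c, fun y z h => by simpa using hc [] y z ⟨rfl, h⟩⟩

theorem IsOptimalPrefixMachine.exists_le (hU : IsOptimalPrefixMachine U) (x : List X) :
    ∃ c : ℕ, prefixComplexity U x [] ≤ c := by
  obtain ⟨c, hc⟩ := hU.exists_le_of_single_program (R := fun _ z => z = x)
    (PrimrecPred.rePred (Primrec.eq.comp Primrec.snd (Primrec.const x)))
    (fun y z z' h h' => h.trans h'.symm)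
  exact ⟨c, hc [] x rfl⟩

/-- Counting: there are infinitely many strings but only finitely many programs of length at most
`N`, and a program has one output. -/
theorem IsOptimalPrefixMachine.exists_large [Nonempty X] (hU : IsOptimalPrefixMachine U) (N : ℕ) :
    ∃ (x : List X) (n : ℕ), N ≤ n ∧ prefixComplexity U x [] = n := by
  by_contra! hcon
  have hp : ∀ x : List X, ∃ p : List Bool, p.length ≤ N ∧ x ∈ U (p, []) := by
    intro x
    obtain ⟨c, hc⟩ := hU.exists_le x
    obtain ⟨n, hn⟩ := ENat.ne_top_iff_exists.1 (ne_top_of_le_ne_top (ENat.natCast_ne_top c) hc)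
    have hlt : prefixComplexity U x [] < N := by
      rw [← hn, Nat.cast_lt]
      by_contra! hle
      exact hcon x n hle hn.symm
    simp only [prefixComplexity, iInf_lt_iff] at hlt
    obtain ⟨p, hxp, hpN⟩ := hlt
    exact ⟨p, by exact_mod_cast hpN.le, hxp⟩
  choose p hpN hxp using hp
  have hinj : Function.Injective p := fun x x' h =>
    Part.mem_unique (hxp x) (h ▸ hxp x')
  have hfin : (Set.range p).Finite :=
    (List.finite_length_le Bool N).subset (by rintro _ ⟨x, rfl⟩; exact hpN x)
  exact Set.infinite_range_of_injective hinj hfin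

/-! ### The machine behind the bound by the minimum over `l` -/

/-- The action of a machine that reads the program tape until it has read a halting program of
`U` with the condition `y`, having read `p` so far. -/
def SelfDelimitingAction (U : List Bool × List X →. List X) (p : List Bool) (y : List X)
    (a : TapeAction X) : Prop :=
  (∃ z, z ∈ U (p, y) ∧ a = TapeAction.halt z) ∨
    ∃ r : List Bool × List X, r.1 ≠ [] ∧ r.2 ∈ U (p ++ r.1, y) ∧ a = TapeAction.readProgram

theorem rePred_selfDelimitingAction (hU : IsPrefixMachine U) :
    REPred fun t : (List Bool × List X) × TapeAction X =>
      SelfDelimitingAction U t.1.1 t.1.2 t.2 := by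
  refine REPred.or (REPred.exists (p := fun (t : (List Bool × List X) × TapeAction X) z =>
    z ∈ U t.1 ∧ t.2 = TapeAction.halt z) (REPred.and ?_ ?_)) (REPred.exists
    (p := fun (t : (List Bool × List X) × TapeAction X) (r : List Bool × List X) =>
      r.1 ≠ [] ∧ r.2 ∈ U (t.1.1 ++ r.1, t.1.2) ∧ t.2 = TapeAction.readProgram)
    (REPred.and ?_ (REPred.and ?_ ?_)))
  · exact hU.1.rePred_mem (Primrec.fst.comp Primrec.fst).to_comp Computable.snd
  · exact PrimrecPred.rePred (Primrec.eq.comp (Primrec.snd.comp Primrec.fst)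
      (Primrec.sumInr.comp Primrec.snd))
  · exact PrimrecPred.rePred (PrimrecPred.not (Primrec.eq.comp (Primrec.fst.comp Primrec.snd)
      (Primrec.const [])))
  · exact hU.1.rePred_mem (Primrec.pair
      (Primrec.list_append.comp (Primrec.fst.comp (Primrec.fst.comp Primrec.fst))
        (Primrec.fst.comp Primrec.snd))
      (Primrec.snd.comp (Primrec.fst.comp Primrec.fst))).to_comp
      (Primrec.snd.comp Primrec.snd).to_comp
  · exact PrimrecPred.rePred (Primrec.eq.comp (Primrec.snd.comp Primrec.fst) (Primrec.const _))

/-- A halting program has no proper halting extension, so halting and reading on exclude each other.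
-/
theorem IsPrefixMachine.selfDelimitingAction_unique (hU : IsPrefixMachine U) {p : List Bool}
    {y : List X} {a a' : TapeAction X} (h : SelfDelimitingAction U p y a)
    (h' : SelfDelimitingAction U p y a') : a = a' := by
  rcases h with ⟨z, hz, rfl⟩ | ⟨r, hr, hw, rfl⟩ <;>
    rcases h' with ⟨z', hz', rfl⟩ | ⟨r', hr', hw', rfl⟩
  · rw [Part.mem_unique hz hz']
  · have := (hU.eq_of_prefix hz hw' (List.prefix_append _ _)).1
    simp at this
    exact absurd this hr'
  · have := (hU.eq_of_prefix hz' hw (List.prefix_append _ _)).1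
    simp at this
    exact absurd this hr
  · rfl

/-- The transition relation of the machine that reads a program of a number `l`, then `l` symbols
of the condition, and then a program that is run with these symbols as the condition. -/
def PrefixConditionAction (U : List Bool × List X →. List X) (code : ℕ → List X)
    (p : List Bool) (x : List X) (a : TapeAction X) : Prop :=
  (SelfDelimitingAction U p [] a ∧ a = TapeAction.readProgram) ∨
    ∃ v : (List Bool × List Bool) × ℕ, p = v.1.1 ++ v.1.2 ∧ code v.2 ∈ U (v.1.1, []) ∧
      ((x.length < v.2 ∧ a = TapeAction.readCondition) ∨
        (x.length = v.2 ∧ SelfDelimitingAction U v.1.2 x a))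

theorem rePred_prefixConditionAction (hU : IsPrefixMachine U) {code : ℕ → List X}
    (hcode : Computable code) : REPred fun t : (List Bool × List X) × TapeAction X =>
      PrefixConditionAction U code t.1.1 t.1.2 t.2 := by
  refine REPred.or (REPred.and ?_ ?_) (REPred.exists
    (p := fun (t : (List Bool × List X) × TapeAction X) (v : (List Bool × List Bool) × ℕ) =>
      t.1.1 = v.1.1 ++ v.1.2 ∧ code v.2 ∈ U (v.1.1, []) ∧
      ((t.1.2.length < v.2 ∧ t.2 = TapeAction.readCondition) ∨
        (t.1.2.length = v.2 ∧ SelfDelimitingAction U v.1.2 t.1.2 t.2)))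
    (REPred.and ?_ (REPred.and ?_ (REPred.or (PrimrecPred.rePred (PrimrecPred.and ?_ ?_))
      (REPred.and ?_ ?_)))))
  · exact (rePred_selfDelimitingAction hU).comp (Primrec.pair (Primrec.pair
      (Primrec.fst.comp Primrec.fst) (Primrec.const [])) Primrec.snd).to_comp
  · exact PrimrecPred.rePred (Primrec.eq.comp Primrec.snd (Primrec.const _))
  · exact PrimrecPred.rePred (Primrec.eq.comp (Primrec.fst.comp (Primrec.fst.comp Primrec.fst))
      (Primrec.list_append.comp (Primrec.fst.comp (Primrec.fst.comp Primrec.snd))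
        (Primrec.snd.comp (Primrec.fst.comp Primrec.snd))))
  · exact hU.1.rePred_mem (Primrec.pair (Primrec.fst.comp (Primrec.fst.comp Primrec.snd))
      (Primrec.const [])).to_comp (hcode.comp (Primrec.snd.comp Primrec.snd).to_comp)
  · exact Primrec.nat_lt.comp
      (Primrec.list_length.comp (Primrec.snd.comp (Primrec.fst.comp Primrec.fst)))
      (Primrec.snd.comp Primrec.snd)
  · exact Primrec.eq.comp (Primrec.snd.comp Primrec.fst) (Primrec.const _)
  · exact PrimrecPred.rePred (Primrec.eq.comp
      (Primrec.list_length.comp (Primrec.snd.comp (Primrec.fst.comp Primrec.fst)))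
      (Primrec.snd.comp Primrec.snd))
  · exact (rePred_selfDelimitingAction hU).comp
      (f := fun u : ((List Bool × List X) × TapeAction X) × ((List Bool × List Bool) × ℕ) =>
        ((u.2.1.2, u.1.1.2), u.1.2)) (Primrec.pair (Primrec.pair
      (Primrec.snd.comp (Primrec.fst.comp Primrec.snd))
      (Primrec.snd.comp (Primrec.fst.comp Primrec.fst))) (Primrec.snd.comp Primrec.fst)).to_comp

/-- Prefix freeness makes the splitting of `p` into a program for a number and a remainder unique,
and injectivity of `code` fixes the number. The step `key` says that once the first program is
complete, its reading phase is over. -/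
theorem IsPrefixMachine.prefixConditionAction_unique (hU : IsPrefixMachine U) {code : ℕ → List X}
    (hcode : Function.Injective code) (p : List Bool) (x : List X) (a a' : TapeAction X)
    (h : PrefixConditionAction U code p x a) (h' : PrefixConditionAction U code p x a') :
    a = a' := by
  have key : ∀ {p₁ p₂ : List Bool} {w : List X} {a : TapeAction X}, p = p₁ ++ p₂ →
      w ∈ U (p₁, []) → SelfDelimitingAction U p [] a → a ≠ TapeAction.readProgram := by
    rintro p₁ p₂ w a rfl hw h rfl
    rcases h with ⟨z, _, hz⟩ | ⟨r, hr, hw', -⟩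
    · cases hz
    · have := (hU.eq_of_prefix hw hw' ⟨p₂ ++ r.1, by simp⟩).1
      simp at this
      exact hr this.2
  rcases h with ⟨h, ha⟩ | ⟨⟨⟨p₁, p₂⟩, l⟩, hp, hl, h⟩ <;>
    rcases h' with ⟨h', ha'⟩ | ⟨⟨⟨p₁', p₂'⟩, l'⟩, hp', hl', h'⟩
  · rw [ha, ha']
  · exact absurd ha (key hp' hl' h)
  · exact absurd ha' (key hp hl h')
  · obtain ⟨rfl, rfl, hll⟩ := hU.eq_of_append_eq hl hl' (hp.symm.trans hp')
    obtain rfl := hcode hll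
    rcases h with ⟨h, ha⟩ | ⟨h, ha⟩ <;> rcases h' with ⟨h', ha'⟩ | ⟨h', ha'⟩
    · rw [ha, ha']
    · omega
    · omega
    · exact hU.selfDelimitingAction_unique ha ha'

theorem IsKStar.le_minBound (hU : IsPrefixMachine U) {C : List X → List X → ℕ∞} (hC : IsKStar C)
    {code : ℕ → List X} (hcode : Computable code) (hcode_inj : Function.Injective code) :
    ∃ c : ℕ, ∀ x y, C x y ≤ minBound U code x y + c := by
  obtain ⟨T, hT⟩ := exists_twicePrefixMachine (rePred_prefixConditionAction hU hcode)
    (hU.prefixConditionAction_unique hcode_inj)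
  obtain ⟨c, hc⟩ := hC.le_complexity T
  refine ⟨c, fun x y => (hc x y).trans ?_⟩
  gcongr
  refine le_iInf₂ fun l hl => ?_
  refine le_iInf_length_add fun p₂ hp₂ => ?_
  rw [add_comm]
  refine le_iInf_length_add fun p₁ hp₁ => ?_
  have hlen : (y.take l).length = l := List.length_take_of_le hl
  -- The run has three phases: the program of `l`, the prefix of `y` of length `l`, the program of
  -- `x` given this prefix.
  have h₁ : T.Reads p₁ [] := by
    refine TwicePrefixMachine.Reads.append_program TwicePrefixMachine.Reads.start
      fun q r hqr hr => (hT _ _ _).2 ?_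
    exact Or.inl ⟨Or.inr ⟨(r, code l), hr, by simpa [← hqr] using hp₁, rfl⟩, rfl⟩
  have h₂ : T.Reads p₁ (y.take l) := by
    refine TwicePrefixMachine.Reads.append_condition h₁
      fun q r hqr hr => (hT _ _ _).2 ?_
    refine Or.inr ⟨((p₁, []), l), by simp, hp₁, Or.inl ⟨?_, rfl⟩⟩
    have := congrArg List.length hqr
    have := List.length_pos_of_ne_nil hr
    simp only [List.length_append, List.nil_append] at *
    omega
  have h₃ : T.Reads (p₁ ++ p₂) (y.take l) := by
    refine TwicePrefixMachine.Reads.append_program h₂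
      fun q r hqr hr => (hT _ _ _).2 ?_
    exact Or.inr ⟨((p₁, q), l), rfl, hp₁, Or.inr ⟨hlen, Or.inr
      ⟨(r, x), hr, by simpa [← hqr] using hp₂, rfl⟩⟩⟩
  have hout : T.Outputs (p₁ ++ p₂) (y.take l) x :=
    ⟨h₃, (hT _ _ _).2 (Or.inr ⟨((p₁, p₂), l), rfl, hp₁, Or.inr ⟨hlen, Or.inl ⟨x, hp₂, rfl⟩⟩⟩)⟩
  simpa using TwicePrefixMachine.complexity_le hout (List.take_prefix l y)

theorem IsOptimalPrefixMachine.minBound_le (hU : IsOptimalPrefixMachine U) (code : ℕ → List X) :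
    ∃ c : ℕ, ∀ x y, minBound U code x y ≤ prefixComplexity U x [] + c := by
  obtain ⟨c, hc⟩ := hU.exists_le (code 0)
  refine ⟨c, fun x y => ?_⟩
  have h : minBound U code x y ≤
      prefixComplexity U x (y.take 0) + prefixComplexity U (code 0) [] :=
    iInf₂_le (f := fun (l : ℕ) (_ : l ≤ y.length) =>
      prefixComplexity U x (y.take l) + prefixComplexity U (code l) []) 0 (Nat.zero_le _)
  rw [List.take_zero] at h
  exact h.trans (by gcongr)

/-! ### Conditions that separate the bounds -/

/-- The string `aˡ` is computable from `l`, so a program for `l` followed by a program for `x` given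
`aˡ` is a self-delimiting description of `x` without a condition. -/
theorem IsOptimalPrefixMachine.le_add_replicate (hU : IsOptimalPrefixMachine U)
    {code : ℕ → List X} (hcode : Computable code) (hcode_inj : Function.Injective code) (a : X) :
    ∃ c : ℕ, ∀ x l, prefixComplexity U x [] ≤
      prefixComplexity U x (List.replicate l a) + prefixComplexity U (code l) [] + c := by
  obtain ⟨c, hc⟩ := hU.le_of_prefixFree
    (R := fun p _ z => ∃ v : (List Bool × List Bool) × ℕ, p = v.1.1 ++ v.1.2 ∧
      code v.2 ∈ U (v.1.1, []) ∧ z ∈ U (v.1.2, List.replicate v.2 a))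
    (REPred.exists
      (p := fun (t : (List Bool × List X) × List X) (v : (List Bool × List Bool) × ℕ) =>
        t.1.1 = v.1.1 ++ v.1.2 ∧ code v.2 ∈ U (v.1.1, []) ∧
          t.2 ∈ U (v.1.2, List.replicate v.2 a)) (REPred.and
        (PrimrecPred.rePred (Primrec.eq.comp (Primrec.fst.comp (Primrec.fst.comp Primrec.fst))
          (Primrec.list_append.comp (Primrec.fst.comp (Primrec.fst.comp Primrec.snd))
            (Primrec.snd.comp (Primrec.fst.comp Primrec.snd)))))
        (REPred.and
          (hU.1.1.rePred_mem (Primrec.pair (Primrec.fst.comp (Primrec.fst.comp Primrec.snd))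
            (Primrec.const [])).to_comp (hcode.comp (Primrec.snd.comp Primrec.snd).to_comp))
          (hU.1.1.rePred_mem (Primrec.pair (Primrec.snd.comp (Primrec.fst.comp Primrec.snd))
            ((Primrec.list_replicate a).comp (Primrec.snd.comp Primrec.snd))).to_comp
            (Primrec.snd.comp Primrec.fst).to_comp))))
    (by
      rintro _ _ y z z' ⟨⟨⟨p₁, p₂⟩, l⟩, rfl, hl, hz⟩ ⟨⟨⟨p₁', p₂'⟩, l'⟩, rfl, hl', hz'⟩ ⟨r, h⟩
      simp only [List.append_assoc] at h hl hl' hz hz' ⊢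
      obtain ⟨rfl, h, hll⟩ := hU.1.eq_of_append_eq hl hl' h
      obtain rfl := hcode_inj hll
      obtain ⟨rfl, rfl⟩ := hU.1.eq_of_prefix hz hz' ⟨r, h⟩
      exact ⟨rfl, rfl⟩)
  refine ⟨c, fun x l => ?_⟩
  rw [add_assoc]
  refine le_iInf_length_add fun p₂ hp₂ => ?_
  rw [add_left_comm]
  refine le_iInf_length_add fun p₁ hp₁ => ?_
  have := hc (p₁ ++ p₂) [] x ⟨((p₁, p₂), l), rfl, hp₁, hp₂⟩
  rwa [List.length_append, Nat.cast_add, add_assoc] at this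

/-- The successor is the length of `aⁿb`: the full length of that condition already describes `x`.
-/
theorem IsOptimalPrefixMachine.le_code_encode (hU : IsOptimalPrefixMachine U)
    {code : ℕ → List X} (hcode : Computable code) (hcode_inj : Function.Injective code) :
    ∃ c : ℕ, ∀ x : List X, prefixComplexity U x [] ≤
      prefixComplexity U (code (Encodable.encode x + 1)) [] + c := by
  obtain ⟨c, hc⟩ := hU.le_of_prefixFree
    (R := fun p _ z => code (Encodable.encode z + 1) ∈ U (p, []))
    (hU.1.1.rePred_mem (Primrec.pair (Primrec.fst.comp Primrec.fst) (Primrec.const [])).to_comp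
      (hcode.comp (Primrec.succ.comp (Primrec.encode.comp Primrec.snd)).to_comp))
    (by
      intro p q y z z' hz hz' hpq
      obtain ⟨rfl, h⟩ := hU.1.eq_of_prefix hz hz' hpq
      exact ⟨rfl, Encodable.encode_injective (Nat.succ_injective (hcode_inj h))⟩)
  exact ⟨c, fun x => le_iInf_length_add fun p hp => hc p [] x hp⟩

/-- The condition `aⁿb` where `n` is the number of `x`. -/
def markedUnary (a b : X) (x : List X) : List X :=
  List.replicate (Encodable.encode x) a ++ [b]

/-- The symbol `b` serves as an end marker: the machine reads the condition until it meets `b`,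
never touches the program tape, and prints the string numbered by the count of `a`. -/
theorem IsKStar.exists_le_markedUnary {C : List X → List X → ℕ∞} (hC : IsKStar C) {a b : X}
    (hab : a ≠ b) : ∃ c : ℕ, ∀ x, C x (markedUnary a b x) ≤ c := by
  have hmem : ∀ x : List X, b ∈ markedUnary a b x := fun x => by simp [markedUnary]
  obtain ⟨T, hT⟩ := exists_twicePrefixMachine
    (R := fun (_ : List Bool) (x : List X) (act : TapeAction X) =>
      (¬ (∃ c ∈ x, c = b) ∧ act = TapeAction.readCondition) ∨
        ∃ z, x = markedUnary a b z ∧ act = TapeAction.halt z)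
    (REPred.or
      (PrimrecPred.rePred (PrimrecPred.and
        (PrimrecPred.not ((Primrec.eq.comp Primrec.id (Primrec.const b)).exists_mem_list.comp
          (Primrec.snd.comp Primrec.fst)))
        (Primrec.eq.comp Primrec.snd (Primrec.const _))))
      (REPred.exists (p := fun (t : (List Bool × List X) × TapeAction X) (z : List X) =>
          t.1.2 = markedUnary a b z ∧ t.2 = TapeAction.halt z)
        (PrimrecPred.rePred (PrimrecPred.and
          (Primrec.eq.comp (Primrec.snd.comp (Primrec.fst.comp Primrec.fst))
            (Primrec.list_append.comp
              ((Primrec.list_replicate a).comp (Primrec.encode.comp Primrec.snd))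
              (Primrec.const [b])))
          (Primrec.eq.comp (Primrec.snd.comp Primrec.fst) (Primrec.sumInr.comp Primrec.snd))))))
    (by
      rintro p x act act' (⟨h, rfl⟩ | ⟨z, hz, rfl⟩) (⟨h', rfl⟩ | ⟨z', hz', rfl⟩)
      · rfl
      · exact absurd ⟨b, hz' ▸ hmem z', rfl⟩ h
      · exact absurd ⟨b, hz ▸ hmem z, rfl⟩ h'
      · have := congrArg List.length (hz.symm.trans hz')
        simp only [markedUnary, List.length_append, List.length_replicate, List.length_singleton,
          add_left_inj] at this
        rw [Encodable.encode_injective this])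
  obtain ⟨c, hc⟩ := hC.le_complexity T
  refine ⟨c, fun x => (hc x _).trans ?_⟩
  have hreads : T.Reads [] (markedUnary a b x) := by
    refine TwicePrefixMachine.Reads.append_condition (x := []) (w := markedUnary a b x)
      TwicePrefixMachine.Reads.start fun q r hqr hr => (hT _ _ _).2 (Or.inl ⟨?_, rfl⟩)
    rintro ⟨c, hc, rfl⟩
    -- A proper prefix of `aⁿb` consists of `a` only, so the machine has not yet seen its marker.
    have hq : List.replicate (Encodable.encode x) a = q ++ r.dropLast := by
      have := congrArg List.dropLast hqr
      rwa [markedUnary, List.dropLast_concat, List.dropLast_append_of_ne_nil hr] at this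
    have hc' : c ∈ List.replicate (Encodable.encode x) a := by
      rw [hq]
      exact List.mem_append_left _ (by simpa using hc)
    exact hab (List.eq_of_mem_replicate hc').symm
  have hout : T.Outputs [] (markedUnary a b x) x :=
    ⟨hreads, (hT _ _ _).2 (Or.inr ⟨x, rfl, rfl⟩)⟩
  simpa using add_le_add_left (TwicePrefixMachine.complexity_le hout List.prefix_rfl) (c : ℕ∞)

/-- A prefix of `aⁿb` either is some `aˡ`, no more informative than `l`, or is the whole string, and
then `l = n + 1` yields `x`. -/
theorem IsOptimalPrefixMachine.le_minBound_markedUnary (hU : IsOptimalPrefixMachine U)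
    {code : ℕ → List X} (hcode : Computable code) (hcode_inj : Function.Injective code) (a b : X) :
    ∃ c : ℕ, ∀ x, prefixComplexity U x [] ≤ minBound U code x (markedUnary a b x) + c := by
  obtain ⟨c₁, hc₁⟩ := hU.le_add_replicate hcode hcode_inj a
  obtain ⟨c₂, hc₂⟩ := hU.le_code_encode hcode hcode_inj
  refine ⟨c₁ + c₂, fun x => tsub_le_iff_right.1 (le_iInf₂ fun l hl => tsub_le_iff_right.2 ?_)⟩
  simp only [markedUnary, List.length_append, List.length_replicate, List.length_singleton] at hl
  rcases Nat.lt_or_ge (Encodable.encode x) l with hlt | hle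
  · obtain rfl : l = Encodable.encode x + 1 := by omega
    calc _ ≤ _ := hc₂ x
      _ ≤ _ := by
        push_cast
        exact add_le_add le_add_self le_add_self
  · have htake : (markedUnary a b x).take l = List.replicate l a := by
      rw [markedUnary, List.take_append_of_le_length (by simpa using hle), List.take_replicate,
        min_eq_left hle]
    rw [htake]
    calc _ ≤ _ := hc₁ x l
      _ ≤ _ := by
        push_cast
        exact add_le_add le_rfl le_self_add

theorem IsOptimalPrefixMachine.exists_le_replicate (hU : IsOptimalPrefixMachine U) (a : X) :
    ∃ c : ℕ, ∀ x : List X,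
      prefixComplexity U x (List.replicate (Encodable.encode x) a) ≤ c := by
  obtain ⟨c, hc⟩ := hU.exists_le_of_single_program
    (R := fun y z => y = List.replicate (Encodable.encode z) a)
    (PrimrecPred.rePred (Primrec.eq.comp Primrec.fst
      ((Primrec.list_replicate a).comp (Primrec.encode.comp Primrec.snd))))
    (fun y z z' h h' => Encodable.encode_injective
      (by simpa using congrArg List.length (h.symm.trans h')))
  exact ⟨c, fun x => hc _ x rfl⟩

end PrefixMachine

/-! ### From gaps to the failure of equality, and the theorem -/

theorem EqWithinLittleO.symm {X : Type*} {K : List X → ℕ∞} {A B : List X → List X → ℕ∞}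
    (h : EqWithinLittleO K A B) : EqWithinLittleO K B A := by
  obtain ⟨f, hf, h⟩ := h
  exact ⟨f, hf, fun x y n hn => (h x y n hn).symm⟩

theorem not_eqWithinLittleO_of_gap {X : Type*} {K : List X → ℕ∞} {A B : List X → List X → ℕ∞}
    (hK : ∀ N : ℕ, ∃ x n, N ≤ n ∧ K x = (n : ℕ))
    (hgap : ∃ c : ℕ, ∀ x, ∃ y, A x y ≤ c ∧ K x ≤ B x y + c) : ¬ EqWithinLittleO K A B := by
  rintro ⟨f, hf, h⟩
  obtain ⟨c, hc⟩ := hgap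
  obtain ⟨N, hN⟩ := eventually_atTop.1 (hf.bound (c := 1 / 2) (by norm_num))
  -- The gap forces `n ≤ 2c + f n`, while `f n ≤ n / 2` from `N` on; hence `n ≤ 4c`, which `4c + 1`
  -- excludes.
  obtain ⟨x, n, hn, hx⟩ := hK (max N (4 * c + 1))
  obtain ⟨y, hA, hB⟩ := hc x
  have hle : n ≤ c + f n + c := by
    have : (n : ℕ∞) ≤ c + f n + c := by
      calc (n : ℕ∞) = K x := hx.symm
        _ ≤ B x y + c := hB
        _ ≤ A x y + f n + c := by gcongr; exact (h x y n hx).2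
        _ ≤ c + f n + c := by gcongr
    exact_mod_cast this
  have hfn := hN n (le_trans (le_max_left _ _) hn)
  simp only [Real.norm_natCast] at hfn
  have h₁ : (n : ℝ) ≤ c + f n + c := by exact_mod_cast hle
  have h₂ : (4 * c + 1 : ℝ) ≤ n := by exact_mod_cast le_trans (le_max_right _ _) hn
  linarith

theorem lemma7 {X : Type*} [Primcodable X] [Finite X] [Nontrivial X]
    (U : List Bool × List X →. List X) (hU : IsOptimalPrefixMachine U)
    (Kstar : List X → List X → ℕ∞) (hKstar : IsKStar Kstar)
    (code : ℕ → List X) (hcode : Computable code) (hcode_inj : Function.Injective code) :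
    -- the chain of inequalities
    (∃ c : ℕ, ∀ x y : List X,
      prefixComplexity U x y ≤ Kstar x y + c ∧
      Kstar x y ≤ minBound U code x y + c ∧
      minBound U code x y ≤ prefixComplexity U x [] + c) ∧
    -- none of the three bounds equals `Kstar` within `o(K(x))`
    ¬ EqWithinLittleO (fun x => prefixComplexity U x []) Kstar
        (fun x y => prefixComplexity U x y) ∧
    ¬ EqWithinLittleO (fun x => prefixComplexity U x []) Kstar (minBound U code) ∧
    ¬ EqWithinLittleO (fun x => prefixComplexity U x []) Kstar
        (fun x _ => prefixComplexity U x []) ∧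
    -- the first gap is attained
    (∃ c : ℕ, ∀ x : List X, ∃ y : List X,
      prefixComplexity U x y ≤ c ∧
      Kstar x y ≤ prefixComplexity U x [] + c ∧
      prefixComplexity U x [] ≤ Kstar x y + c ∧
      minBound U code x y ≤ prefixComplexity U x [] + c ∧
      prefixComplexity U x [] ≤ minBound U code x y + c) ∧
    -- the second gap is attained
    (∃ c : ℕ, ∀ x : List X, ∃ y : List X,
      prefixComplexity U x y ≤ c ∧
      Kstar x y ≤ c ∧
      minBound U code x y ≤ prefixComplexity U x [] + c ∧
      prefixComplexity U x [] ≤ minBound U code x y + c) := by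
  obtain ⟨a, b, hab⟩ := exists_pair_ne X
  have hchain : ∃ c : ℕ, ∀ x y : List X,
      prefixComplexity U x y ≤ Kstar x y + c ∧
      Kstar x y ≤ minBound U code x y + c ∧
      minBound U code x y ≤ prefixComplexity U x [] + c := by
    obtain ⟨E, hE, rfl⟩ := hKstar.exists_set
    obtain ⟨c₁, hc₁⟩ := hU.le_setComplexity hE
    obtain ⟨c₂, hc₂⟩ := hKstar.le_minBound hU.1 hcode hcode_inj
    obtain ⟨c₃, hc₃⟩ := hU.minBound_le code
    refine ⟨c₁ + c₂ + c₃, fun x y => ⟨(hc₁ x y).trans ?_, (hc₂ x y).trans ?_,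
      (hc₃ x y).trans ?_⟩⟩ <;> gcongr <;> omega
  have hgap₁ : ∃ c : ℕ, ∀ x : List X, ∃ y : List X,
      prefixComplexity U x y ≤ c ∧
      Kstar x y ≤ prefixComplexity U x [] + c ∧
      prefixComplexity U x [] ≤ Kstar x y + c ∧
      minBound U code x y ≤ prefixComplexity U x [] + c ∧
      prefixComplexity U x [] ≤ minBound U code x y + c := by
    obtain ⟨c, hc⟩ := hchain
    obtain ⟨E, hE, rfl⟩ := hKstar.exists_set
    obtain ⟨c₁, hc₁⟩ := hU.exists_le_replicate a
    obtain ⟨c₂, hc₂⟩ := hU.le_setComplexity_replicate hE a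
    refine ⟨c₁ + c₂ + c + c, fun x => ⟨List.replicate (Encodable.encode x) a, ?_⟩⟩
    obtain ⟨-, h₂, h₃⟩ := hc x (List.replicate (Encodable.encode x) a)
    have h₄ := hc₁ x
    have h₅ := hc₂ x (Encodable.encode x)
    refine ⟨h₄.trans (by norm_cast; omega), ?_, h₅.trans (by gcongr; omega),
      h₃.trans (by gcongr; omega), ?_⟩
    · calc _ ≤ _ := h₂
        _ ≤ prefixComplexity U x [] + c + c := by gcongr
        _ ≤ _ := by rw [add_assoc]; gcongr; norm_cast; omega
    · calc _ ≤ _ := h₅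
        _ ≤ minBound U code x _ + c + c₂ := by gcongr
        _ ≤ _ := by rw [add_assoc]; gcongr; norm_cast; omega
  have hgap₂ : ∃ c : ℕ, ∀ x : List X, ∃ y : List X,
      prefixComplexity U x y ≤ c ∧
      Kstar x y ≤ c ∧
      minBound U code x y ≤ prefixComplexity U x [] + c ∧
      prefixComplexity U x [] ≤ minBound U code x y + c := by
    obtain ⟨c, hc⟩ := hchain
    obtain ⟨c₁, hc₁⟩ := hKstar.exists_le_markedUnary hab
    obtain ⟨c₂, hc₂⟩ := hU.le_minBound_markedUnary hcode hcode_inj a b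
    refine ⟨c₁ + c₂ + c, fun x => ⟨markedUnary a b x, ?_⟩⟩
    obtain ⟨h₁, -, h₃⟩ := hc x (markedUnary a b x)
    refine ⟨?_, (hc₁ x).trans (by norm_cast; omega), h₃.trans (by gcongr; omega),
      (hc₂ x).trans (by gcongr; omega)⟩
    calc _ ≤ _ := h₁
      _ ≤ (c₁ : ℕ∞) + c := by gcongr; exact hc₁ x
      _ ≤ _ := by norm_cast; omega
  have hlarge := hU.exists_large
  refine ⟨hchain, fun h => ?_, ?_, ?_, hgap₁, hgap₂⟩
  -- For `aⁿ` it is `K(x|y)` that is bounded and `K_*` that is large, so the roles are exchanged.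
  -- The other two bounds are refuted by `aⁿb`, where `K_*` is bounded.
  · refine not_eqWithinLittleO_of_gap hlarge ?_ h.symm
    obtain ⟨c, hc⟩ := hgap₁
    exact ⟨c, fun x => (hc x).imp fun y h => ⟨h.1, h.2.2.1⟩⟩
  · refine not_eqWithinLittleO_of_gap hlarge ?_
    obtain ⟨c, hc⟩ := hgap₂
    exact ⟨c, fun x => (hc x).imp fun y h => ⟨h.2.1, h.2.2.2⟩⟩
  · refine not_eqWithinLittleO_of_gap hlarge ?_
    obtain ⟨c, hc⟩ := hgap₂
    exact ⟨c, fun x => (hc x).imp fun y h => ⟨h.2.1, le_self_add⟩⟩
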